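/- Let $Q$ be a smooth, connected, second-countable, finite-dimensional manifold, let $M=\mathbb{R}\times TQ\times\mathbb{R}$ with natural coordinates $(t,q^i,v^i,z)$, and let $L\in C^\infty(M)$ be a regular Lagrangian, i.e. its fibre Hessian $\big(\partial^2L/\partial v^i\partial v^j\big)$ is nondegenerate everywhere. Let $\mathcal S=\frac{\partial}{\partial v^i}\otimes dq^i$ be the vertical endomorphism, $\Delta=v^i\frac{\partial}{\partial v^i}$ the Liouville vector field, $E_L=\Delta(L)-L$ the Lagrangian energy, $\eta_L=dz-{}^t\mathcal S\circ dL$ the contact Lagrangian form and $\tau=dt$. Let $R_t,R_z$ be the Reeb vector fields, characterized by $\tau(R_t)=1$, $\eta_L(R_t)=0$, $\iota_{R_t}d\eta_L=0$ and $\tau(R_z)=0$, $\eta_L(R_z)=1$, $\iota_{R_z}d\eta_L=0$, and let $\Gamma_L$ be the Herglotz–Euler–Lagrange vector field, i.e. the unique vector field with $$\iota_{\Gamma_L}d\eta_L=dE_L-R_t(E_L)\,\tau-R_z(E_L)\,\eta_L,\qquad \eta_L(\Gamma_L)=-E_L,\qquad \tau(\Gamma_L)=1 .$$ A diffeomorphism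 $\Phi\colon M\to M$ is a *generalized dynamical symmetry* if $\eta_L(\Phi_*\Gamma_L)=\eta_L(\Gamma_L)$ and $\Phi^*t=t$. A smooth vector field $Y$ on $M$ is a *generalized infinitesimal dynamical symmetry* if $\eta_L([Y,\Gamma_L])=0$ and $\tau(Y)=0$. A function $f\in C^\infty(M)$ is a *dissipated quantity* if $\Gamma_L(f)=-R_z(E_L)\,f$. Let $\mathrm{pr}\colon M\to\mathbb{R}\times TQ$ be the projection. A *change of action* is a diffeomorphism $\Phi\colon M\to M$ with $\mathrm{pr}\circ\Phi\circ\gamma=\mathrm{id}$ for every (smooth) section $\gamma$ of $\mathrm{pr}$, and an *infinitesimal change of action* is a smooth vector field $Z$ on $M$ with $T\mathrm{pr}\circ Z=0$. 1. A change of action of the form $\Phi\colon(t,q,v,z)\mapsto(t,q,v,\Phi_z(t,q,v,z))$ is a generalized dynamical symmetry if and only if $\Gamma_L(\Phi_z)=L\circ\Phi$. 2. An infinitesimal change of action $Z=\zeta(t,q,v,z)\,\frac{\partial}{\partial z}$ is a generalized infinitesimal dynamical symmetry if and only if $\zeta$ is a dissipated quantity; moreover, $\zeta$ is a dissipated quantity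 if and only if $\Gamma_L(\zeta)=\zeta\,\frac{\partial L}{\partial z}$. -/

import Mathlib

open scoped Manifold ContDiff

noncomputable section

namespace Cocontact

/-! ### Calculus on a general manifold -/

section General

variable {F : Type*} [NormedAddCommGroup F] [NormedSpace ℝ F]
  {H : Type*} [TopologicalSpace H] {J : ModelWithCorners ℝ F H}
  {M : Type*} [TopologicalSpace M] [ChartedSpace H M]

/-- A differential one-form on `M` (smoothness is a separate condition). -/
abbrev OneForm (J : ModelWithCorners ℝ F H) (M : Type*) [TopologicalSpace M] [ChartedSpace H M] :=
  ∀ x : M, TangentSpace J x →L[ℝ] ℝ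

/-- A vector field on `M` (smoothness is a separate condition). -/
abbrev VField (J : ModelWithCorners ℝ F H) (M : Type*) [TopologicalSpace M] [ChartedSpace H M] :=
  ∀ x : M, TangentSpace J x

/-- Smoothness of a vector field, as a section of the tangent bundle. -/
def IsSmoothVField [IsManifold J 1 M] (X : VField J M) : Prop :=
  ContMDiff J J.tangent ∞ (fun x => (⟨x, X x⟩ : TangentBundle J M))

/-- The one-form `α` read in the preferred chart at `x₀`, that is, its pull-back by the inverse of
the chart. -/
def OneForm.inChart (α : OneForm J M) (x₀ : M) (y : F) : F →L[ℝ] ℝ :=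
  (α ((extChartAt J x₀).symm y)).comp
    (mfderivWithin 𝓘(ℝ, F) J (extChartAt J x₀).symm (Set.range J) y)

/-- The contraction `ι_u dα` at `x`, where `dα` is the exterior derivative of the one-form `α`:
in the preferred chart at `x`, `dα (u, v) = (D_u α) v - (D_v α) u`. -/
def contractD (α : OneForm J M) (x : M) (u : TangentSpace J x) : TangentSpace J x →L[ℝ] ℝ :=
  let A : F →L[ℝ] F →L[ℝ] ℝ := fderivWithin ℝ (α.inChart x) (Set.range J) (extChartAt J x x)
  let T : TangentSpace J x →L[ℝ] F := mfderiv J 𝓘(ℝ, F) (extChartAt J x) x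
  ((A - A.flip) (T u)).comp T

/-- The time Reeb vector field of `(τ, η)`: at each point, the solution `u` of
`ι_u τ = 1`, `ι_u η = 0`, `ι_u dη = 0` (unique on a Lagrangian phase space with regular
Lagrangian). -/
def reebT (τ η : OneForm J M) : VField J M := fun x =>
  Classical.epsilon fun u : TangentSpace J x => τ x u = 1 ∧ η x u = 0 ∧ contractD η x u = 0

/-- The contact Reeb vector field of `(τ, η)`: at each point, the solution `u` of
`ι_u τ = 0`, `ι_u η = 1`, `ι_u dη = 0`. -/
def reebZ (τ η : OneForm J M) : VField J M := fun x =>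
  Classical.epsilon fun u : TangentSpace J x => τ x u = 0 ∧ η x u = 1 ∧ contractD η x u = 0

/-- The cocontact Hamiltonian vector field `X_h` of `(M, τ, η, h)`: at each point, the solution `u`
of `ι_u dη = dh - R_z(h) η - R_t(h) τ`, `ι_u η = -h`, `ι_u τ = 1`. -/
def hamiltonianVField (τ η : OneForm J M) (h : M → ℝ) : VField J M := fun x =>
  Classical.epsilon fun u : TangentSpace J x =>
    contractD η x u = mvfderiv J h x - mvfderiv J h x (reebZ τ η x) • η x
        - mvfderiv J h x (reebT τ η x) • τ x ∧
      η x u = -h x ∧ τ x u = 1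

/-- Dissipated quantities of `(M, τ, η, h)`: smooth functions `f` with `X_h(f) = -R_z(h) f`. -/
def IsDissipatedQuantity (τ η : OneForm J M) (h f : M → ℝ) : Prop :=
  ContMDiff J 𝓘(ℝ, ℝ) ∞ f ∧
    ∀ x, mvfderiv J f x (hamiltonianVField τ η h x) = -mvfderiv J h x (reebZ τ η x) * f x

/-- Generalized infinitesimal dynamical symmetries of `(M, τ, η, h)`: vector fields `Y` with
`η([Y, X_h]) = 0` and `ι_Y τ = 0`. -/
def IsGeneralizedInfinitesimalDynamicalSymmetry [IsManifold J 1 M]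
    (τ η : OneForm J M) (h : M → ℝ) (Y : VField J M) : Prop :=
  IsSmoothVField Y ∧
    (∀ x, η x (VectorField.mlieBracket J Y (hamiltonianVField τ η h) x) = 0) ∧
    ∀ x, τ x (Y x) = 0

/-- The push-forward `Φ_* X` of a vector field by a diffeomorphism, i.e. its pull-back by `Φ⁻¹`. -/
def pushforward (Φ : M ≃ₘ⟮J, J⟯ M) (X : VField J M) : VField J M :=
  VectorField.mpullback J J Φ.symm X

/-- Generalized dynamical symmetries of `(ℝ × N, τ, η, h)`: diffeomorphisms `Φ` with
`η(Φ_* X_h) = η(X_h)` and `Φ^* t = t`, where `t` is the first projection. -/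
def IsGeneralizedDynamicalSymmetry
    (τ η : OneForm (𝓘(ℝ, ℝ).prod J) (ℝ × M)) (h : ℝ × M → ℝ)
    (Φ : (ℝ × M) ≃ₘ⟮𝓘(ℝ, ℝ).prod J, 𝓘(ℝ, ℝ).prod J⟯ (ℝ × M)) : Prop :=
  (∀ x, η x (pushforward Φ (hamiltonianVField τ η h) x) = η x (hamiltonianVField τ η h x)) ∧
    ∀ x, (Φ x).1 = x.1

end General

/-! ### The Lagrangian phase space `ℝ × TQ × ℝ` -/

section Lagrangian

variable {E : Type*} [NormedAddCommGroup E] [NormedSpace ℝ E]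
  {Q : Type*} [TopologicalSpace Q] [ChartedSpace E Q] [IsManifold 𝓘(ℝ, E) ∞ Q]

variable (E) in
/-- The model with corners of `TQ × ℝ`. -/
abbrev contactModel : ModelWithCorners ℝ ((E × E) × ℝ) (ModelProd (ModelProd E E) ℝ) :=
  (𝓘(ℝ, E).tangent).prod 𝓘(ℝ, ℝ)

variable (E) in
/-- The model with corners of `ℝ × TQ × ℝ`. -/
abbrev phaseModel :
    ModelWithCorners ℝ (ℝ × (E × E) × ℝ) (ModelProd ℝ (ModelProd (ModelProd E E) ℝ)) :=
  𝓘(ℝ, ℝ).prod (contactModel E)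

variable (E Q) in
/-- The phase space `ℝ × TQ × ℝ`, with points `(t, ⟨q, v⟩, z)`. -/
abbrev Phase := ℝ × TangentBundle 𝓘(ℝ, E) Q × ℝ

instance tangentBundle_isManifold :
    IsManifold (𝓘(ℝ, E).tangent) ∞ (TangentBundle 𝓘(ℝ, E) Q) := by
  have : IsManifold 𝓘(ℝ, E) (∞ + 1) Q := ‹IsManifold 𝓘(ℝ, E) ∞ Q›
  have : ContMDiffVectorBundle ∞ E (TangentSpace 𝓘(ℝ, E) : Q → Type _) 𝓘(ℝ, E) :=
    TangentBundle.contMDiffVectorBundle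
  exact Bundle.TotalSpace.isManifold E (TangentSpace 𝓘(ℝ, E))

/-- The inclusion `w ↦ (t, ⟨q, w⟩, z)` of the fibre through `x = (t, ⟨q, v⟩, z)`. -/
def fibreIncl (x : Phase E Q) (w : TangentSpace 𝓘(ℝ, E) x.2.1.proj) : Phase E Q :=
  (x.1, ⟨x.2.1.proj, w⟩, x.2.2)

/-- The vertical lift at `x = (t, ⟨q, v⟩, z)` of a tangent vector `w` at `q`: the velocity at `s = 0`
of `s ↦ (t, ⟨q, v + s w⟩, z)`. In coordinates, `w^i ∂/∂q^i ↦ w^i ∂/∂v^i`. -/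
def vertLift (x : Phase E Q) :
    TangentSpace 𝓘(ℝ, E) x.2.1.proj →L[ℝ] TangentSpace (phaseModel E) x :=
  mfderiv 𝓘(ℝ, E) (phaseModel E) (fun w : E => fibreIncl x w) x.2.1.snd

/-- The vertical endomorphism: `S = ∂/∂v^i ⊗ dq^i`, i.e. the vertical lift of the projection to
`TQ` of a vector tangent to the phase space. -/
def vertEndo (x : Phase E Q) :
    TangentSpace (phaseModel E) x →L[ℝ] TangentSpace (phaseModel E) x :=
  (vertLift x).comp (mfderiv (phaseModel E) 𝓘(ℝ, E) (fun y : Phase E Q => y.2.1.proj) x)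

/-- The Liouville vector field `Δ = v^i ∂/∂v^i`. -/
def liouville : VField (phaseModel E) (Phase E Q) := fun x => vertLift x x.2.1.snd

/-- The one-form `dt`. -/
def dt : OneForm (phaseModel E) (Phase E Q) := fun x =>
  mvfderiv (phaseModel E) (fun y : Phase E Q => y.1) x

/-- The one-form `dz`. -/
def dz : OneForm (phaseModel E) (Phase E Q) := fun x =>
  mvfderiv (phaseModel E) (fun y : Phase E Q => y.2.2) x

/-- The vector field `∂/∂z`. -/
def partialZ : VField (phaseModel E) (Phase E Q) := fun x =>
  mfderiv 𝓘(ℝ, ℝ) (phaseModel E) (fun s : ℝ => ((x.1, x.2.1, s) : Phase E Q)) x.2.2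
    ((NormedSpace.fromTangentSpace x.2.2).symm 1)

/-- The Lagrangian energy `E_L = Δ(L) - L`. -/
def energy (L : Phase E Q → ℝ) : Phase E Q → ℝ := fun x =>
  mvfderiv (phaseModel E) L x (liouville x) - L x

/-- The Cartan one-form `θ_L = ᵗS ∘ dL`. -/
def cartanForm (L : Phase E Q → ℝ) : OneForm (phaseModel E) (Phase E Q) := fun x =>
  (mvfderiv (phaseModel E) L x).comp (vertEndo x)

/-- The contact Lagrangian form `η_L = dz - θ_L`. -/
def etaL (L : Phase E Q → ℝ) : OneForm (phaseModel E) (Phase E Q) := fun x =>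
  dz x - cartanForm L x

/-- Regularity of a Lagrangian: the fibre Hessian `∂²L/∂v^i∂v^j` is everywhere nondegenerate. -/
def IsRegular (L : Phase E Q → ℝ) : Prop :=
  ∀ (x : Phase E Q) (w : E),
    (∀ w' : E, fderiv ℝ (fderiv ℝ (fun u : E => L (fibreIncl x u))) x.2.1.snd w w' = 0) → w = 0

/-- The Herglotz-Euler-Lagrange vector field `Γ_L` of a regular Lagrangian: the cocontact
Hamiltonian vector field of `(ℝ × TQ × ℝ, dt, η_L, E_L)`. -/
def herglotzVField (L : Phase E Q → ℝ) : VField (phaseModel E) (Phase E Q) :=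
  hamiltonianVField dt (etaL L) (energy L)

/-- The projection `ℝ × TQ × ℝ → ℝ × TQ`. -/
def prTQ (x : Phase E Q) : ℝ × TangentBundle 𝓘(ℝ, E) Q := (x.1, x.2.1)

/-- Changes of action: diffeomorphisms `Φ` with `pr ∘ Φ ∘ γ = id` for each (smooth) section `γ` of
the projection `pr : ℝ × TQ × ℝ → ℝ × TQ`. -/
def IsChangeOfAction (Φ : Phase E Q ≃ₘ⟮phaseModel E, phaseModel E⟯ Phase E Q) : Prop :=
  ∀ γ : ℝ × TangentBundle 𝓘(ℝ, E) Q → Phase E Q,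
    ContMDiff (𝓘(ℝ, ℝ).prod (𝓘(ℝ, E).tangent)) (phaseModel E) ∞ γ →
    (∀ y, prTQ (γ y) = y) → ∀ y, prTQ (Φ (γ y)) = y

/-- Infinitesimal changes of action: vector fields `Z` with `T pr ∘ Z = 0`. -/
def IsInfinitesimalChangeOfAction (Z : VField (phaseModel E) (Phase E Q)) : Prop :=
  IsSmoothVField Z ∧
    ∀ x, mfderiv (phaseModel E) (𝓘(ℝ, ℝ).prod (𝓘(ℝ, E).tangent)) prTQ x (Z x) = 0

end Lagrangian

end Cocontact

end

/-!
Besides `η_L(Γ_L) = -E_L`, which is part of the definition of the Herglotz vector field, the proof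
rests on two facts:

* the second-order condition: the projection of `Γ_L` at `(t, ⟨q, v⟩, z)` to the configuration
  manifold is `v` (`mfderiv_base_herglotzVField`);
* the identity `R_z(E_L) = -∂L/∂z` (`mvfderiv_energy_reebZ_eq`).

For a change of action `Φ`, the vector `TΦ(Γ_L)` has `dz`-component `Γ_L(Φ_z)` and still projects
to `v`, so that `η_L(TΦ(Γ_L)) = Γ_L(Φ_z) - Δ(L) ∘ Φ`, whereas
`η_L(Γ_L) ∘ Φ = -E_L ∘ Φ = L ∘ Φ - Δ(L) ∘ Φ`. Comparing the two gives the first statement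
(`isGeneralizedDynamicalSymmetry_iff`). For `Z = ζ ∂/∂z`, the bracket satisfies
`η_L([Z, Γ_L]) = ζ ∂L/∂z - Γ_L(ζ)` (`etaL_mlieBracket`), which gives the second one.

The vector fields `R_t`, `R_z` and `Γ_L` are defined pointwise as solutions of linear equations,
so the equations have to be shown solvable, and the Lie bracket moreover requires `Γ_L` to be
differentiable. All of this is done in a chart. With `ℓ` the Lagrangian in coordinates,
`η_L = dz - (∂ℓ/∂v^i) dq^i` (`etaL_chartFrame`), and the equations for `Γ_L` hold exactly for
`∂/∂t + v^i ∂/∂q^i + A^i ∂/∂v^i + ℓ ∂/∂z`, where `A` solves a linear system whose matrix is the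
fibre Hessian (`localHerglotz_iff_eq`). Regularity makes this system uniquely solvable, with a
solution depending smoothly on the point. Since `ι_u dη` is defined at each point with the chart
preferred at that point, while differentiability concerns a whole neighbourhood, the exterior
derivative has to be known to be independent of the chart (`contractD_symm_apply`).
-/

namespace Cocontact

/-! ### One-forms and their exterior derivatives in charts -/

section General

open Set Filter Topology

variable {F : Type*} [NormedAddCommGroup F] [NormedSpace ℝ F]
  {H : Type*} [TopologicalSpace H] {J : ModelWithCorners ℝ F H}
  {M : Type*} [TopologicalSpace M] [ChartedSpace H M]

/-- Tangent spaces at equal points are identified with the same model space, so the value of a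
one-form may be moved along an equality of points. -/
theorem OneForm.comp_congr_point (α : OneForm J M) {p q : M} (h : p = q) (T : F →L[ℝ] F) :
    (show F →L[ℝ] ℝ from α p).comp T = (show F →L[ℝ] ℝ from α q).comp T := by
  subst h; rfl

variable [J.Boundaryless] [IsManifold J ∞ M]

theorem contDiffAt_chart_transition (x₀ x₁ : M) {p : F} (hp : p ∈ (extChartAt J x₁).target)
    (hp' : (extChartAt J x₁).symm p ∈ (extChartAt J x₀).source) :
    ContDiffAt ℝ ∞ (extChartAt J x₀ ∘ (extChartAt J x₁).symm) p := by
  have h := contDiffWithinAt_ext_coord_change (I := J) (n := ∞) x₀ x₁ (y := p)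
    (by rw [PartialEquiv.trans_source]; exact ⟨hp, hp'⟩)
  rwa [J.range_eq_univ, contDiffWithinAt_univ] at h

theorem mdifferentiableAt_extChartAt_symm (x₀ : M) {y : F} (hy : y ∈ (extChartAt J x₀).target) :
    MDifferentiableAt 𝓘(ℝ, F) J (extChartAt J x₀).symm y := by
  have : IsManifold J 1 M := .of_le (n := ∞) (by simp)
  have h := mdifferentiableWithinAt_extChartAt_symm (I := J) hy
  rwa [J.range_eq_univ, mdifferentiableWithinAt_univ] at h

/-- Transition formula for the local expressions of a one-form: near `p`, the expression in the
chart at `x₁` is the pull-back, by the transition map, of the expression in the chart at `x₀`. -/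
theorem OneForm.inChart_eventuallyEq (α : OneForm J M) (x₀ x₁ : M) {p : F}
    (hp : p ∈ (extChartAt J x₁).target)
    (hp' : (extChartAt J x₁).symm p ∈ (extChartAt J x₀).source) :
    α.inChart x₁ =ᶠ[𝓝 p] fun y =>
      (α.inChart x₀ ((extChartAt J x₀ ∘ (extChartAt J x₁).symm) y)).comp
        (fderiv ℝ (extChartAt J x₀ ∘ (extChartAt J x₁).symm) y) := by
  have h1 : (extChartAt J x₁).target ∈ 𝓝 p := (isOpen_extChartAt_target x₁).mem_nhds hp
  have h2 : (extChartAt J x₁).symm ⁻¹' (extChartAt J x₀).source ∈ 𝓝 p :=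
    (continuousAt_extChartAt_symm'' hp).preimage_mem_nhds
      ((isOpen_extChartAt_source x₀).mem_nhds hp')
  filter_upwards [eventually_mem_nhds_iff.2 h1, eventually_mem_nhds_iff.2 h2] with y hy1 hy2
  have m1 := mem_of_mem_nhds hy1
  have m2 : (extChartAt J x₁).symm y ∈ (extChartAt J x₀).source :=
    mem_of_mem_nhds (s := (extChartAt J x₁).symm ⁻¹' (extChartAt J x₀).source) hy2
  set κ := extChartAt J x₀ ∘ (extChartAt J x₁).symm with hκ
  have hκy : κ y ∈ (extChartAt J x₀).target := (extChartAt J x₀).map_source m2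
  have hpt : (extChartAt J x₀).symm (κ y) = (extChartAt J x₁).symm y :=
    (extChartAt J x₀).left_inv m2
  have hev : (extChartAt J x₁).symm =ᶠ[𝓝 y] (extChartAt J x₀).symm ∘ κ := by
    filter_upwards [hy2] with z hz
    exact ((extChartAt J x₀).left_inv hz).symm
  have hd : mfderiv 𝓘(ℝ, F) J (extChartAt J x₁).symm y =
      (mfderiv 𝓘(ℝ, F) J (extChartAt J x₀).symm (κ y)).comp (fderiv ℝ κ y) := by
    rw [hev.mfderiv_eq]
    have hκd : MDifferentiableAt 𝓘(ℝ, F) 𝓘(ℝ, F) κ y :=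
      ((contDiffAt_chart_transition x₀ x₁ m1 m2).differentiableAt (by simp)).mdifferentiableAt
    exact (mfderiv_comp y (mdifferentiableAt_extChartAt_symm x₀ hκy) hκd).trans
      (by rw [mfderiv_eq_fderiv]; rfl)
  simp only [OneForm.inChart, J.range_eq_univ, mfderivWithin_univ]
  rw [hd]
  exact (α.comp_congr_point hpt _).symm

/-- The contraction `ι_u dα` may be computed in any chart: the exterior derivative is independent
of the chart, by the symmetry of the second derivative of the transition map. -/
theorem contractD_symm_apply (α : OneForm J M) (x₀ : M) {y : F}
    (hy : y ∈ (extChartAt J x₀).target) (hα : DifferentiableAt ℝ (α.inChart x₀) y) (u w : F) :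
    contractD α ((extChartAt J x₀).symm y)
        (mfderivWithin 𝓘(ℝ, F) J (extChartAt J x₀).symm (range J) y u)
        (mfderivWithin 𝓘(ℝ, F) J (extChartAt J x₀).symm (range J) y w) =
      fderiv ℝ (α.inChart x₀) y u w - fderiv ℝ (α.inChart x₀) y w u := by
  have : IsManifold J 1 M := .of_le (n := ∞) (by simp)
  set x := (extChartAt J x₀).symm y with hx
  have hxs : x ∈ (extChartAt J x₀).source := (extChartAt J x₀).map_target hy
  set p := extChartAt J x x with hp
  have hpt : p ∈ (extChartAt J x).target := mem_extChartAt_target x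
  have hpx : (extChartAt J x).symm p = x := extChartAt_to_inv x
  set κ := extChartAt J x₀ ∘ (extChartAt J x).symm with hκ
  have hκp : κ p = y := by
    simp only [hκ, Function.comp_apply, hpx]
    exact (extChartAt J x₀).right_inv hy
  have hκs : ContDiffAt ℝ ∞ κ p := contDiffAt_chart_transition x₀ x hpt (by rwa [hpx])
  -- The derivative of the transition map identifies the coordinates of a vector in both charts.
  have hT : ∀ a : F, fderiv ℝ κ p (mfderiv J 𝓘(ℝ, F) (extChartAt J x) x
      (mfderivWithin 𝓘(ℝ, F) J (extChartAt J x₀).symm (range J) y a)) = a := by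
    intro a
    have hev : extChartAt J x₀ =ᶠ[𝓝 x] κ ∘ extChartAt J x := by
      filter_upwards [(isOpen_extChartAt_source (I := J) x).mem_nhds (mem_extChartAt_source x)]
        with z hz
      simp only [hκ, Function.comp_apply, (extChartAt J x).left_inv hz]
    have h1 : mfderiv J 𝓘(ℝ, F) (extChartAt J x₀) x =
        (fderiv ℝ κ p).comp (mfderiv J 𝓘(ℝ, F) (extChartAt J x) x) := by
      rw [hev.mfderiv_eq]
      have hκd : MDifferentiableAt 𝓘(ℝ, F) 𝓘(ℝ, F) κ (extChartAt J x x) :=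
        (hκs.differentiableAt (by simp)).mdifferentiableAt
      exact (mfderiv_comp x hκd (mdifferentiableAt_extChartAt (mem_chart_source H x))).trans
        (by rw [mfderiv_eq_fderiv]; rfl)
    have h2 := mfderiv_extChartAt_comp_mfderivWithin_extChartAt_symm (I := J) hy
    have h3 := DFunLike.congr_fun h2 a
    have h4 := DFunLike.congr_fun h1
      (mfderivWithin 𝓘(ℝ, F) J (extChartAt J x₀).symm (range J) y a)
    exact h4.symm.trans h3
  have hA : fderivWithin ℝ (α.inChart x) (range J) p =
      fderiv ℝ (fun z => (α.inChart x₀ (κ z)).comp (fderiv ℝ κ z)) p := by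
    rw [J.range_eq_univ, fderivWithin_univ]
    exact (α.inChart_eventuallyEq x₀ x hpt (by rwa [hpx])).fderiv_eq
  have hD : HasFDerivAt (fun z => (α.inChart x₀ (κ z)).comp (fderiv ℝ κ z)) _ p :=
    HasFDerivAt.clm_comp
      (c := fun z => α.inChart x₀ (κ z)) (d := fun z => fderiv ℝ κ z)
      (HasFDerivAt.comp p (g := α.inChart x₀) (by rw [hκp]; exact hα.hasFDerivAt)
        (hκs.differentiableAt (by simp)).hasFDerivAt)
      ((hκs.fderiv_right (m := 1) (by norm_cast)).differentiableAt (by simp)).hasFDerivAt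
  -- Antisymmetrization removes the term with the second derivative of the transition map.
  have hsym : IsSymmSndFDerivAt ℝ κ p := hκs.isSymmSndFDerivAt (by simpa using ENat.LEInfty.out)
  have key : ∀ a b : F, fderivWithin ℝ (α.inChart x) (range J) p a b -
      fderivWithin ℝ (α.inChart x) (range J) p b a =
      fderiv ℝ (α.inChart x₀) y (fderiv ℝ κ p a) (fderiv ℝ κ p b) -
      fderiv ℝ (α.inChart x₀) y (fderiv ℝ κ p b) (fderiv ℝ κ p a) := by
    intro a b
    rw [hA, hD.fderiv]
    simp [hsym.eq a b]
  have := key (mfderiv J 𝓘(ℝ, F) (extChartAt J x) x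
      (mfderivWithin 𝓘(ℝ, F) J (extChartAt J x₀).symm (range J) y u))
    (mfderiv J 𝓘(ℝ, F) (extChartAt J x) x
      (mfderivWithin 𝓘(ℝ, F) J (extChartAt J x₀).symm (range J) y w))
  rw [hT, hT] at this
  exact this

end General

/-! ### The Herglotz equations in coordinates -/

section Local

variable {E : Type*} [NormedAddCommGroup E] [NormedSpace ℝ E]

variable (E) in
/-- The inclusion `a ↦ (0, (0, a), 0)` of the velocity directions in the coordinate space. -/
noncomputable def velIncl : E →L[ℝ] ℝ × (E × E) × ℝ :=
  (ContinuousLinearMap.inr ℝ ℝ ((E × E) × ℝ)).comp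
    ((ContinuousLinearMap.inl ℝ (E × E) ℝ).comp (ContinuousLinearMap.inr ℝ E E))

variable (E) in
/-- The position component `(t, (q, v), z) ↦ q`. -/
noncomputable def posProj : ℝ × (E × E) × ℝ →L[ℝ] E :=
  (ContinuousLinearMap.fst ℝ E E).comp ((ContinuousLinearMap.fst ℝ (E × E) ℝ).comp
    (ContinuousLinearMap.snd ℝ ℝ ((E × E) × ℝ)))

variable (E) in
/-- The velocity component `(t, (q, v), z) ↦ v`. -/
noncomputable def velProj : ℝ × (E × E) × ℝ →L[ℝ] E :=
  (ContinuousLinearMap.snd ℝ E E).comp ((ContinuousLinearMap.fst ℝ (E × E) ℝ).comp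
    (ContinuousLinearMap.snd ℝ ℝ ((E × E) × ℝ)))

variable (E) in
/-- The action component `(t, (q, v), z) ↦ z`. -/
noncomputable def actProj : ℝ × (E × E) × ℝ →L[ℝ] ℝ :=
  (ContinuousLinearMap.snd ℝ (E × E) ℝ).comp (ContinuousLinearMap.snd ℝ ℝ ((E × E) × ℝ))

@[simp] theorem velIncl_apply (a : E) : velIncl E a = (0, (0, a), 0) := rfl
@[simp] theorem posProj_apply (u : ℝ × (E × E) × ℝ) : posProj E u = u.2.1.1 := rfl
@[simp] theorem velProj_apply (u : ℝ × (E × E) × ℝ) : velProj E u = u.2.1.2 := rfl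
@[simp] theorem actProj_apply (u : ℝ × (E × E) × ℝ) : actProj E u = u.2.2 := rfl

/-- The coordinate expression `dz - (∂ℓ/∂v^i) dq^i` of the contact Lagrangian form. -/
noncomputable def localEta (ℓ : ℝ × (E × E) × ℝ → ℝ) (y : ℝ × (E × E) × ℝ) :
    ℝ × (E × E) × ℝ →L[ℝ] ℝ :=
  actProj E - (fderiv ℝ ℓ y).comp ((velIncl E).comp (posProj E))

/-- The coordinate expression `v^i ∂ℓ/∂v^i - ℓ` of the Lagrangian energy. -/
noncomputable def localEnergy (ℓ : ℝ × (E × E) × ℝ → ℝ) (y : ℝ × (E × E) × ℝ) : ℝ :=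
  fderiv ℝ ℓ y (velIncl E (velProj E y)) - ℓ y

/-- The fibre Hessian `∂²ℓ/∂v^i∂v^j`. -/
noncomputable def localHess (ℓ : ℝ × (E × E) × ℝ → ℝ) (y : ℝ × (E × E) × ℝ) : E →L[ℝ] E →L[ℝ] ℝ :=
  (((velIncl E).precomp ℝ).comp (fderiv ℝ (fderiv ℝ ℓ) y)).comp (velIncl E)

@[simp] theorem localEta_apply (ℓ : ℝ × (E × E) × ℝ → ℝ) (y u : ℝ × (E × E) × ℝ) :
    localEta ℓ y u = u.2.2 - fderiv ℝ ℓ y (0, (0, u.2.1.1), 0) := rfl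

theorem localHess_apply (ℓ : ℝ × (E × E) × ℝ → ℝ) (y : ℝ × (E × E) × ℝ) (a b : E) :
    localHess ℓ y a b = fderiv ℝ (fderiv ℝ ℓ) y (0, (0, a), 0) (0, (0, b), 0) := rfl

variable {ℓ : ℝ × (E × E) × ℝ → ℝ} {y : ℝ × (E × E) × ℝ}

theorem differentiableAt_fderiv_of_contDiffAt (hℓ : ContDiffAt ℝ ∞ ℓ y) :
    DifferentiableAt ℝ (fderiv ℝ ℓ) y :=
  (hℓ.fderiv_right (m := 1) (by norm_cast)).differentiableAt (by simp)

theorem hasFDerivAt_localEta (hℓ : ContDiffAt ℝ ∞ ℓ y) :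
    HasFDerivAt (localEta ℓ)
      (-((((velIncl E).comp (posProj E)).precomp ℝ).comp (fderiv ℝ (fderiv ℝ ℓ) y))) y := by
  have h := ((((velIncl E).comp (posProj E)).precomp ℝ).hasFDerivAt.comp y
    (differentiableAt_fderiv_of_contDiffAt hℓ).hasFDerivAt).const_sub (actProj E)
  exact h

theorem fderiv_localEta (hℓ : ContDiffAt ℝ ∞ ℓ y) (u w : ℝ × (E × E) × ℝ) :
    fderiv ℝ (localEta ℓ) y u w = - fderiv ℝ (fderiv ℝ ℓ) y u (0, (0, w.2.1.1), 0) := by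
  rw [(hasFDerivAt_localEta hℓ).fderiv]; rfl

theorem fderiv_localEnergy (hℓ : ContDiffAt ℝ ∞ ℓ y) (w : ℝ × (E × E) × ℝ) :
    fderiv ℝ (localEnergy ℓ) y w = fderiv ℝ (fderiv ℝ ℓ) y w (0, (0, y.2.1.2), 0) +
      fderiv ℝ ℓ y (0, (0, w.2.1.2), 0) - fderiv ℝ ℓ y w := by
  have h := ((differentiableAt_fderiv_of_contDiffAt hℓ).hasFDerivAt.clm_apply
    ((velIncl E).comp (velProj E)).hasFDerivAt).sub (hℓ.differentiableAt (by simp)).hasFDerivAt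
  have h' : HasFDerivAt (localEnergy ℓ) _ y := h
  rw [h'.fderiv]
  simp [add_comm]

/-- The coordinate expression of `dη_L (u, w)`. -/
noncomputable def localOmega (ℓ : ℝ × (E × E) × ℝ → ℝ) (y u w : ℝ × (E × E) × ℝ) : ℝ :=
  fderiv ℝ (localEta ℓ) y u w - fderiv ℝ (localEta ℓ) y w u

theorem localOmega_eq (hℓ : ContDiffAt ℝ ∞ ℓ y) (u w : ℝ × (E × E) × ℝ) :
    localOmega ℓ y u w = fderiv ℝ (fderiv ℝ ℓ) y w (0, (0, u.2.1.1), 0) -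
      fderiv ℝ (fderiv ℝ ℓ) y u (0, (0, w.2.1.1), 0) := by
  rw [localOmega, fderiv_localEta hℓ, fderiv_localEta hℓ]; ring

/-- A vector of the coordinate space is the combination of its components. -/
theorem clm_apply_components {G : Type*} [NormedAddCommGroup G] [NormedSpace ℝ G]
    (f : ℝ × (E × E) × ℝ →L[ℝ] G) (u : ℝ × (E × E) × ℝ) :
    f u = u.1 • f (1, (0, 0), 0) + f (0, (u.2.1.1, 0), 0) + f (0, (0, u.2.1.2), 0) +
      u.2.2 • f (0, (0, 0), 1) := by
  rw [← map_smul, ← map_smul, ← map_add, ← map_add, ← map_add]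
  congr 1
  ext <;> simp

/-- If `dη_L (u, ·)` agrees on velocity directions with the Hessian form of `q`, then `q` is the
position component of `u`. For `q = 0` this applies to the Reeb vector fields, and for `q` the
velocity it gives the second-order condition for the Herglotz vector field. -/
theorem pos_eq_zero_of_localOmega (hℓ : ContDiffAt ℝ ∞ ℓ y)
    (hreg : ∀ a, localHess ℓ y a = 0 → a = 0) {u : ℝ × (E × E) × ℝ} {q : E}
    (h : ∀ b, localOmega ℓ y u (0, (0, b), 0) =
      fderiv ℝ (fderiv ℝ ℓ) y (0, (0, b), 0) (0, (0, q), 0)) :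
    u.2.1.1 = q := by
  have hsym : IsSymmSndFDerivAt ℝ ℓ y := hℓ.isSymmSndFDerivAt (by simpa using ENat.LEInfty.out)
  have hs := fun b => hsym.eq (0, (0, b), 0) (0, (0, u.2.1.1 - q), 0)
  rw [← sub_eq_zero]
  apply hreg
  ext b
  have h1 := h b
  rw [localOmega_eq hℓ] at h1
  rw [localHess_apply, ← hs]
  have h2 : ((0, (0, u.2.1.1 - q), 0) : ℝ × (E × E) × ℝ) =
    (0, (0, u.2.1.1), 0) - (0, (0, q), 0) := by simp
  have h3 : ((0, (0, 0), 0) : ℝ × (E × E) × ℝ) = 0 := rfl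
  simp only [h3, map_zero, sub_zero] at h1
  rw [h2, map_sub, h1]; simp

/-- Along the kernel of `dη_L`, the energy varies as `-ℓ` does in the directions `∂/∂t` and `∂/∂z`:
the remaining terms cancel by the contraction of `u` with `dη_L` in the direction `v^i ∂/∂q^i`. -/
theorem fderiv_localEnergy_of_reeb (hℓ : ContDiffAt ℝ ∞ ℓ y)
    (hreg : ∀ a, localHess ℓ y a = 0 → a = 0) {u : ℝ × (E × E) × ℝ}
    (h : ∀ w, localOmega ℓ y u w = 0) :
    fderiv ℝ (localEnergy ℓ) y u =
      -(u.1 * fderiv ℝ ℓ y (1, (0, 0), 0) + u.2.2 * fderiv ℝ ℓ y (0, (0, 0), 1)) := by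
  have h3 : ((0, (0, 0), 0) : ℝ × (E × E) × ℝ) = 0 := rfl
  have hq : u.2.1.1 = 0 := pos_eq_zero_of_localOmega hℓ hreg fun b => by
    rw [h, h3, map_zero]
  -- The direction `v^i ∂/∂q^i` produces exactly the Hessian term in the derivative of the energy.
  have h1 := h (0, (y.2.1.2, 0), 0)
  rw [localOmega_eq hℓ, hq, h3, map_zero] at h1
  rw [fderiv_localEnergy hℓ, clm_apply_components (fderiv ℝ ℓ y) u, hq, h3, map_zero]
  simp only [smul_eq_mul]
  simp only at h1
  linarith

/-- The linear form determining the acceleration in the Herglotz equations: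
`∂ℓ/∂q^i + (∂ℓ/∂z)(∂ℓ/∂v^i) - ∂²ℓ/∂t∂v^i - v^j ∂²ℓ/∂q^j∂v^i - ℓ ∂²ℓ/∂z∂v^i`. -/
noncomputable def herglotzForce (ℓ : ℝ × (E × E) × ℝ → ℝ) (y : ℝ × (E × E) × ℝ) : E →L[ℝ] ℝ :=
  (fderiv ℝ ℓ y).comp ((ContinuousLinearMap.inr ℝ ℝ ((E × E) × ℝ)).comp
      ((ContinuousLinearMap.inl ℝ (E × E) ℝ).comp (ContinuousLinearMap.inl ℝ E E))) +
    fderiv ℝ ℓ y (0, (0, 0), 1) • (fderiv ℝ ℓ y).comp (velIncl E) -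
    (fderiv ℝ (fderiv ℝ ℓ) y (1, (y.2.1.2, 0), ℓ y)).comp (velIncl E)

theorem herglotzForce_apply (b : E) : herglotzForce ℓ y b = fderiv ℝ ℓ y (0, (b, 0), 0) +
    fderiv ℝ ℓ y (0, (0, 0), 1) * fderiv ℝ ℓ y (0, (0, b), 0) -
    fderiv ℝ (fderiv ℝ ℓ) y (1, (y.2.1.2, 0), ℓ y) (0, (0, b), 0) := rfl

/-- The equations of the Herglotz vector field in coordinates, for the known values of the Reeb
derivatives of the energy. -/
def LocalHerglotz (ℓ : ℝ × (E × E) × ℝ → ℝ) (y u : ℝ × (E × E) × ℝ) : Prop :=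
  (∀ w, localOmega ℓ y u w = fderiv ℝ (localEnergy ℓ) y w +
      fderiv ℝ ℓ y (0, (0, 0), 1) * localEta ℓ y w + fderiv ℝ ℓ y (1, (0, 0), 0) * w.1) ∧
    localEta ℓ y u = -localEnergy ℓ y ∧ u.1 = 1

/-- The coordinate form of the Herglotz equations: velocity directions give the second-order
condition, position directions give the linear equation for the acceleration, and the value of
`η_L` gives the action component. -/
theorem localHerglotz_iff (hℓ : ContDiffAt ℝ ∞ ℓ y)
    (hreg : ∀ a, localHess ℓ y a = 0 → a = 0) (u : ℝ × (E × E) × ℝ) :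
    LocalHerglotz ℓ y u ↔
      ∃ a, localHess ℓ y a = herglotzForce ℓ y ∧ u = (1, (y.2.1.2, a), ℓ y) := by
  have h3 : ((0, (0, 0), 0) : ℝ × (E × E) × ℝ) = 0 := rfl
  have hdec : ∀ a : E, ((1, (y.2.1.2, a), ℓ y) : ℝ × (E × E) × ℝ) =
    (1, (y.2.1.2, 0), ℓ y) + (0, (0, a), 0) := by simp
  constructor
  · rintro ⟨h1, h2, ht⟩
    have hq : u.2.1.1 = y.2.1.2 := pos_eq_zero_of_localOmega hℓ hreg fun b => by
      rw [h1, fderiv_localEnergy hℓ, localEta_apply]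
      simp [h3]
    have hz : u.2.2 = ℓ y := by
      rw [localEta_apply, hq] at h2
      simp only [localEnergy, velIncl_apply, velProj_apply] at h2
      linarith
    refine ⟨u.2.1.2, ?_, by rw [← hq, ← hz, ← ht]⟩
    have hu : u = (1, (y.2.1.2, 0), ℓ y) + (0, (0, u.2.1.2), 0) := by
      rw [← hdec, ← hq, ← hz, ← ht]
    ext b
    have hb := h1 (0, (b, 0), 0)
    rw [localOmega_eq hℓ, fderiv_localEnergy hℓ, localEta_apply, hq] at hb
    rw [localHess_apply, herglotzForce_apply]
    rw [hu] at hb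
    simp only [h3, map_zero, map_add, add_apply] at hb
    linarith
  · rintro ⟨a, ha, rfl⟩
    refine ⟨fun w => ?_, by simp [localEnergy], rfl⟩
    have hb := DFunLike.congr_fun ha w.2.1.1
    rw [localHess_apply, herglotzForce_apply] at hb
    rw [localOmega_eq hℓ, fderiv_localEnergy hℓ, localEta_apply,
      clm_apply_components (fderiv ℝ ℓ y) w, hdec]
    simp only [map_add, add_apply, smul_eq_mul]
    simp only [Prod.mk_add_mk, add_zero, zero_add]
    linarith

section Solve

variable [FiniteDimensional ℝ E]

/-- In finite dimension, a nondegenerate bilinear form is a linear isomorphism onto the dual. -/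
noncomputable def nondegEquiv (B : E →L[ℝ] E →L[ℝ] ℝ) (hB : ∀ a, B a = 0 → a = 0) :
    E ≃L[ℝ] (E →L[ℝ] ℝ) :=
  (LinearMap.linearEquivOfInjective (B : E →ₗ[ℝ] (E →L[ℝ] ℝ))
    ((injective_iff_map_eq_zero _).2 hB)
    (by rw [← (LinearMap.toContinuousLinearMap (𝕜 := ℝ) (E := E) (F' := ℝ)).finrank_eq]
        exact Subspace.dual_finrank_eq.symm)).toContinuousLinearEquiv

theorem coe_nondegEquiv (B : E →L[ℝ] E →L[ℝ] ℝ) (hB : ∀ a, B a = 0 → a = 0) :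
    (nondegEquiv B hB : E →L[ℝ] (E →L[ℝ] ℝ)) = B := by
  ext a : 1
  rfl

theorem exists_nondeg_apply_eq (B : E →L[ℝ] E →L[ℝ] ℝ) (hB : ∀ a, B a = 0 → a = 0)
    (c : E →L[ℝ] ℝ) : ∃ a, B a = c :=
  ⟨(nondegEquiv B hB).symm c, (nondegEquiv B hB).apply_symm_apply c⟩

/-- The coordinate form of the existence of the Reeb vector fields: with `s = 1`, `r = 0` the time
Reeb vector field, and with `s = 0`, `r = 1` the contact one. -/
theorem exists_local_reeb (hℓ : ContDiffAt ℝ ∞ ℓ y)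
    (hreg : ∀ a, localHess ℓ y a = 0 → a = 0) (s r : ℝ) :
    ∃ u : ℝ × (E × E) × ℝ, u.1 = s ∧ localEta ℓ y u = r ∧ ∀ w, localOmega ℓ y u w = 0 := by
  have h3 : ((0, (0, 0), 0) : ℝ × (E × E) × ℝ) = 0 := rfl
  obtain ⟨a, ha⟩ := exists_nondeg_apply_eq (localHess ℓ y) hreg
    (-(fderiv ℝ (fderiv ℝ ℓ) y (s, (0, 0), r)).comp (velIncl E))
  refine ⟨(s, (0, a), r), rfl, by simp [h3], fun w => ?_⟩
  rw [localOmega_eq hℓ]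
  have h1 := DFunLike.congr_fun ha w.2.1.1
  rw [localHess_apply] at h1
  have h2 : ((s, (0, a), r) : ℝ × (E × E) × ℝ) = (s, (0, 0), r) + (0, (0, a), 0) := by simp
  simp only [h3, map_zero, h2, map_add, add_apply, h1]
  simp

/-- The acceleration of the Herglotz vector field in coordinates; the inverse is meaningful where
the Hessian is nondegenerate. -/
noncomputable def herglotzAcc (ℓ : ℝ × (E × E) × ℝ → ℝ) (y : ℝ × (E × E) × ℝ) : E :=
  (localHess ℓ y).inverse (herglotzForce ℓ y)

theorem localHerglotz_iff_eq (hℓ : ContDiffAt ℝ ∞ ℓ y)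
    (hreg : ∀ a, localHess ℓ y a = 0 → a = 0) (u : ℝ × (E × E) × ℝ) :
    LocalHerglotz ℓ y u ↔ u = (1, (y.2.1.2, herglotzAcc ℓ y), ℓ y) := by
  rw [localHerglotz_iff hℓ hreg]
  have hinv : ∀ a, localHess ℓ y a = herglotzForce ℓ y ↔ a = herglotzAcc ℓ y := by
    intro a
    rw [herglotzAcc, ← coe_nondegEquiv (localHess ℓ y) hreg, ContinuousLinearMap.inverse_equiv]
    exact (nondegEquiv (localHess ℓ y) hreg).eq_symm_apply.symm
  simp [hinv]

/-- The acceleration depends smoothly on the point: the inversion of linear maps is smooth. -/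
theorem differentiableAt_herglotzAcc (hℓ : ContDiffAt ℝ ∞ ℓ y)
    (hreg : ∀ a, localHess ℓ y a = 0 → a = 0) : DifferentiableAt ℝ (herglotzAcc ℓ) y := by
  have h1 : DifferentiableAt ℝ (fderiv ℝ ℓ) y := differentiableAt_fderiv_of_contDiffAt hℓ
  have h2 : DifferentiableAt ℝ (fderiv ℝ (fderiv ℝ ℓ)) y :=
    ((hℓ.fderiv_right (m := 2) (by norm_cast)).fderiv_right (m := 1)
      (by norm_num)).differentiableAt (by simp)
  have h0 : DifferentiableAt ℝ ℓ y := hℓ.differentiableAt (by simp)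
  have hH : DifferentiableAt ℝ (localHess ℓ) y := by
    unfold localHess; fun_prop
  have hF : DifferentiableAt ℝ (herglotzForce ℓ) y := by
    unfold herglotzForce; fun_prop
  have hI : DifferentiableAt ℝ (fun z => (localHess ℓ z).inverse) y := by
    refine DifferentiableAt.comp (𝕜 := ℝ) (G := (E →L[ℝ] ℝ) →L[ℝ] E) y
      (g := ContinuousLinearMap.inverse) ?_ hH
    rw [← coe_nondegEquiv (localHess ℓ y) hreg]
    exact (contDiffAt_map_inverse (n := 1) (nondegEquiv (localHess ℓ y) hreg)).differentiableAt
      (by simp)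
  exact hI.clm_apply hF

end Solve

end Local

/-! ### Charts of the phase space -/

section PhaseChart

open Set Filter Topology

variable {E : Type*} [NormedAddCommGroup E] [NormedSpace ℝ E]
  {Q : Type*} [TopologicalSpace Q] [ChartedSpace E Q] [IsManifold 𝓘(ℝ, E) ∞ Q]

/-- The inverse of the preferred chart of the phase space at `x₀`. -/
noncomputable def chartInv (x₀ : Phase E Q) : ℝ × (E × E) × ℝ → Phase E Q :=
  (extChartAt (phaseModel E) x₀).symm

/-- The coordinate frame at `chartInv x₀ y`: the derivative of the inverse of the chart. -/
noncomputable def chartFrame (x₀ : Phase E Q) (y : ℝ × (E × E) × ℝ) :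
    ℝ × (E × E) × ℝ →L[ℝ] TangentSpace (phaseModel E) (chartInv x₀ y) :=
  mfderivWithin 𝓘(ℝ, ℝ × (E × E) × ℝ) (phaseModel E) (extChartAt (phaseModel E) x₀).symm
    (range (phaseModel E)) y

/-- The image of the chart at `x₀`. -/
def chartDom (x₀ : Phase E Q) : Set (ℝ × (E × E) × ℝ) := (extChartAt (phaseModel E) x₀).target

theorem mem_chartDom {x₀ : Phase E Q} {y : ℝ × (E × E) × ℝ} :
    y ∈ chartDom x₀ ↔ y.2.1.1 ∈ (chartAt E x₀.2.1.proj).target := by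
  rw [chartDom, extChartAt_prod, extChartAt_prod, PartialEquiv.prod_target,
    PartialEquiv.prod_target, Set.mem_prod, Set.mem_prod, extChartAt_target, extChartAt_target,
    extChartAt_target]
  have h := TangentBundle.mem_chart_target_iff (I := 𝓘(ℝ, E)) y.2.1 x₀.2.1
  exact ⟨fun h' => h.1 h'.2.1.1, fun h' => ⟨⟨trivial, mem_range_self y.1⟩,
    ⟨h.2 h', mem_range_self (f := 𝓘(ℝ, E).tangent) y.2.1⟩, trivial, mem_range_self y.2.2⟩⟩

theorem isOpen_chartDom (x₀ : Phase E Q) : IsOpen (chartDom x₀) :=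
  isOpen_extChartAt_target x₀

theorem mdifferentiableAt_chartInv {x₀ : Phase E Q} {y : ℝ × (E × E) × ℝ} (hy : y ∈ chartDom x₀) :
    MDifferentiableAt 𝓘(ℝ, ℝ × (E × E) × ℝ) (phaseModel E) (chartInv x₀) y :=
  mdifferentiableAt_extChartAt_symm x₀ hy

theorem chartFrame_eq_mfderiv (x₀ : Phase E Q) (y : ℝ × (E × E) × ℝ) :
    chartFrame x₀ y = mfderiv 𝓘(ℝ, ℝ × (E × E) × ℝ) (phaseModel E) (chartInv x₀) y := by
  rw [chartFrame, (phaseModel E).range_eq_univ, mfderivWithin_univ]; rfl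

/-- The velocity `v` of the point `(t, ⟨q, v⟩, z)`, in the model space. -/
def velocity (x : Phase E Q) : E := x.2.1.snd

/-- The inverse chart in coordinates: the velocity is transported by the derivative of the inverse
of the chart of the configuration manifold. -/
theorem chartInv_eq {x₀ : Phase E Q} {y : ℝ × (E × E) × ℝ} (hy : y ∈ chartDom x₀) :
    chartInv x₀ y = (y.1, ⟨(chartAt E x₀.2.1.proj).symm y.2.1.1,
      mfderiv 𝓘(ℝ, E) 𝓘(ℝ, E) (chartAt E x₀.2.1.proj).symm y.2.1.1 y.2.1.2⟩, y.2.2) := by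
  rw [mem_chartDom] at hy
  have h := tangentMap_chart_symm (I := 𝓘(ℝ, E)) (p := x₀.2.1) (q := ⟨y.2.1.1, y.2.1.2⟩) hy
  exact congrArg (fun p => ((y.1, p, y.2.2) : Phase E Q)) h.symm

theorem fibreIncl_chartInv {x₀ : Phase E Q} {y : ℝ × (E × E) × ℝ} (hy : y ∈ chartDom x₀) (b : E) :
    fibreIncl (chartInv x₀ y)
      (mfderiv 𝓘(ℝ, E) 𝓘(ℝ, E) (chartAt E x₀.2.1.proj).symm y.2.1.1 b) =
    chartInv x₀ (y.1, (y.2.1.1, b), y.2.2) := by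
  have hy' : ((y.1, (y.2.1.1, b), y.2.2) : ℝ × (E × E) × ℝ) ∈ chartDom x₀ := by
    rw [mem_chartDom] at hy ⊢; exact hy
  rw [chartInv_eq hy']
  rfl

theorem velocity_chartInv {x₀ : Phase E Q} {y : ℝ × (E × E) × ℝ} (hy : y ∈ chartDom x₀) :
    velocity (chartInv x₀ y) =
      mfderiv 𝓘(ℝ, E) 𝓘(ℝ, E) (chartAt E x₀.2.1.proj).symm y.2.1.1 y.2.1.2 := by
  have h := chartInv_eq hy
  exact congrArg (fun p : Phase E Q => velocity p) h

/-- The derivative of the inverse of a chart of the configuration manifold, which relates the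
coordinate components of a velocity to the velocity. -/
noncomputable def baseFrame (q₀ : Q) {q : E} (hq : q ∈ (chartAt E q₀).target) : E ≃L[ℝ] E :=
  have : IsManifold 𝓘(ℝ, E) 1 Q := .of_le (n := ∞) (by simp)
  (mdifferentiable_chart (I := 𝓘(ℝ, E)) q₀).symm.mfderiv hq

/-- Replacing the velocity component of a coordinate vector. -/
def withVel (y : ℝ × (E × E) × ℝ) (b : E) : ℝ × (E × E) × ℝ := (y.1, (y.2.1.1, b), y.2.2)

theorem hasFDerivAt_withVel (y : ℝ × (E × E) × ℝ) (b : E) :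
    HasFDerivAt (withVel y) (velIncl E) b := by
  have h := (velIncl E).hasFDerivAt (x := b) |>.const_add (withVel y 0)
  refine h.congr_of_eventuallyEq (Eventually.of_forall fun c => ?_)
  simp [withVel]

theorem withVel_mem_chartDom {x₀ : Phase E Q} {y : ℝ × (E × E) × ℝ} (hy : y ∈ chartDom x₀) (b : E) :
    withVel y b ∈ chartDom x₀ := by
  rw [mem_chartDom] at hy ⊢; exact hy

/-- In coordinates the inclusion of a fibre only changes the velocity component, through a linear
isomorphism. -/
theorem fibreIncl_eq_chartInv {x₀ : Phase E Q} {y : ℝ × (E × E) × ℝ} (hy : y ∈ chartDom x₀)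
    (w : E) :
    fibreIncl (chartInv x₀ y) w =
      chartInv x₀ (withVel y ((baseFrame x₀.2.1.proj (mem_chartDom.1 hy)).symm w)) := by
  refine Eq.trans ?_ (fibreIncl_chartInv hy _)
  exact congrArg (fibreIncl (chartInv x₀ y))
    ((baseFrame x₀.2.1.proj (mem_chartDom.1 hy)).apply_symm_apply w).symm

theorem velocity_eq_baseFrame {x₀ : Phase E Q} {y : ℝ × (E × E) × ℝ} (hy : y ∈ chartDom x₀) :
    velocity (chartInv x₀ y) = baseFrame x₀.2.1.proj (mem_chartDom.1 hy) y.2.1.2 :=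
  velocity_chartInv hy

/-- Vertical lifts in coordinates: `w^i ∂/∂q^i ↦ w^i ∂/∂v^i`. -/
theorem vertLift_baseFrame {x₀ : Phase E Q} {y : ℝ × (E × E) × ℝ} (hy : y ∈ chartDom x₀) (b : E) :
    vertLift (chartInv x₀ y) (baseFrame x₀.2.1.proj (mem_chartDom.1 hy) b) =
      chartFrame x₀ y (0, (0, b), 0) := by
  set e := baseFrame x₀.2.1.proj (mem_chartDom.1 hy) with he
  have hv : e.symm (velocity (chartInv x₀ y)) = y.2.1.2 := by
    rw [velocity_eq_baseFrame hy, ContinuousLinearEquiv.symm_apply_apply]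
  have hwv : withVel y (e.symm (velocity (chartInv x₀ y))) = y := by
    rw [hv]; rfl
  have hfun : (fun w : E => fibreIncl (chartInv x₀ y) w) =
      chartInv x₀ ∘ fun w : E => withVel y (e.symm w) :=
    funext fun w => fibreIncl_eq_chartInv hy w
  have h1 : HasFDerivAt (fun w : E => withVel y (e.symm w))
      ((velIncl E).comp (e.symm : E →L[ℝ] E)) (velocity (chartInv x₀ y)) :=
    (hasFDerivAt_withVel y _).comp _ e.symm.hasFDerivAt
  have h2 := mfderiv_comp_apply_of_eq (I := 𝓘(ℝ, E)) (I' := 𝓘(ℝ, ℝ × (E × E) × ℝ))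
    (I'' := phaseModel E) (f := fun w : E => withVel y (e.symm w)) (x := velocity (chartInv x₀ y))
    (mdifferentiableAt_chartInv hy) h1.differentiableAt.mdifferentiableAt hwv (e b)
  rw [vertLift, hfun]
  refine h2.trans ?_
  rw [mfderiv_eq_fderiv, h1.fderiv, chartFrame_eq_mfderiv]
  exact congrArg (fun c => mfderiv 𝓘(ℝ, ℝ × (E × E) × ℝ) (phaseModel E) (chartInv x₀) y
    (velIncl E c)) (e.symm_apply_apply b)

theorem liouville_chartInv {x₀ : Phase E Q} {y : ℝ × (E × E) × ℝ} (hy : y ∈ chartDom x₀) :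
    liouville (chartInv x₀ y) = chartFrame x₀ y (0, (0, y.2.1.2), 0) := by
  rw [← vertLift_baseFrame hy, ← velocity_eq_baseFrame hy]; rfl

/-- The derivative of a function along the coordinate frame is that of its coordinate
expression. -/
theorem mvfderiv_chartFrame {x₀ : Phase E Q} {y : ℝ × (E × E) × ℝ} (hy : y ∈ chartDom x₀)
    {g : Phase E Q → ℝ} (hg : MDifferentiableAt (phaseModel E) 𝓘(ℝ, ℝ) g (chartInv x₀ y))
    (u : ℝ × (E × E) × ℝ) :
    mvfderiv (phaseModel E) g (chartInv x₀ y) (chartFrame x₀ y u) =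
      fderiv ℝ (g ∘ chartInv x₀) y u := by
  have h := mfderiv_comp_apply y hg (mdifferentiableAt_chartInv hy) u
  rw [mfderiv_eq_fderiv] at h
  rw [chartFrame_eq_mfderiv]
  exact h.symm

theorem mdifferentiableAt_chartInv_of_eventuallyEq {x₀ : Phase E Q} {y : ℝ × (E × E) × ℝ}
    (hy : y ∈ chartDom x₀) {g : Phase E Q → ℝ} {g' : ℝ × (E × E) × ℝ → ℝ}
    (h : ∀ z ∈ chartDom x₀, g (chartInv x₀ z) = g' z) (hg' : DifferentiableAt ℝ g' y) :
    MDifferentiableAt (phaseModel E) 𝓘(ℝ, ℝ) g (chartInv x₀ y) := by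
  have : IsManifold (phaseModel E) 1 (Phase E Q) := .of_le (n := ∞) (by simp)
  have hs : chartInv x₀ y ∈ (extChartAt (phaseModel E) x₀).source :=
    (extChartAt (phaseModel E) x₀).map_target hy
  have hr : extChartAt (phaseModel E) x₀ (chartInv x₀ y) = y :=
    (extChartAt (phaseModel E) x₀).right_inv hy
  have hev : g =ᶠ[𝓝 (chartInv x₀ y)] g' ∘ extChartAt (phaseModel E) x₀ := by
    filter_upwards [(isOpen_extChartAt_source x₀).mem_nhds hs] with z hz
    rw [Function.comp_apply, ← h _ ((extChartAt (phaseModel E) x₀).map_source hz)]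
    exact congrArg g ((extChartAt (phaseModel E) x₀).left_inv hz).symm
  refine MDifferentiableAt.congr_of_eventuallyEq ?_ hev
  refine MDifferentiableAt.comp (I' := 𝓘(ℝ, ℝ × (E × E) × ℝ)) _ ?_
    (mdifferentiableAt_extChartAt (by rwa [extChartAt_source] at hs))
  rw [hr]
  exact hg'.mdifferentiableAt

theorem dt_chartFrame {x₀ : Phase E Q} {y : ℝ × (E × E) × ℝ} (hy : y ∈ chartDom x₀)
    (u : ℝ × (E × E) × ℝ) : dt (chartInv x₀ y) (chartFrame x₀ y u) = u.1 := by
  rw [dt, mvfderiv_chartFrame hy mdifferentiableAt_fst]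
  exact DFunLike.congr_fun (hasFDerivAt_fst (𝕜 := ℝ) (p := y)).fderiv u

theorem dz_chartFrame {x₀ : Phase E Q} {y : ℝ × (E × E) × ℝ} (hy : y ∈ chartDom x₀)
    (u : ℝ × (E × E) × ℝ) : dz (chartInv x₀ y) (chartFrame x₀ y u) = u.2.2 := by
  rw [dz, mvfderiv_chartFrame hy (mdifferentiableAt_snd.snd)]
  exact DFunLike.congr_fun (actProj E).hasFDerivAt.fderiv u

theorem mdifferentiableAt_base (x : Phase E Q) :
    MDifferentiableAt (phaseModel E) 𝓘(ℝ, E) (fun y : Phase E Q => y.2.1.proj) x := by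
  have h : MDifferentiableAt (𝓘(ℝ, E).tangent) 𝓘(ℝ, E)
      (Bundle.TotalSpace.proj : TangentBundle 𝓘(ℝ, E) Q → Q) x.2.1 :=
    (Bundle.contMDiff_proj (n := 1) (TangentSpace 𝓘(ℝ, E) : Q → Type _)).mdifferentiableAt (by simp)
  exact h.comp x (mdifferentiableAt_snd.fst)

theorem mfderiv_base_chartFrame {x₀ : Phase E Q} {y : ℝ × (E × E) × ℝ} (hy : y ∈ chartDom x₀)
    (u : ℝ × (E × E) × ℝ) :
    mfderiv (phaseModel E) 𝓘(ℝ, E) (fun y : Phase E Q => y.2.1.proj) (chartInv x₀ y)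
      (chartFrame x₀ y u) = baseFrame x₀.2.1.proj (mem_chartDom.1 hy) u.2.1.1 := by
  have : IsManifold 𝓘(ℝ, E) 1 Q := .of_le (n := ∞) (by simp)
  have h := mfderiv_comp_apply y (mdifferentiableAt_base _) (mdifferentiableAt_chartInv hy) u
  rw [chartFrame_eq_mfderiv]
  refine h.symm.trans ?_
  have hfun : (fun y : Phase E Q => y.2.1.proj) ∘ chartInv x₀ =
      (chartAt E x₀.2.1.proj).symm ∘ posProj E := rfl
  have h2 := mfderiv_comp_apply (I := 𝓘(ℝ, ℝ × (E × E) × ℝ)) (I' := 𝓘(ℝ, E)) (I'' := 𝓘(ℝ, E)) y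
    (g := (chartAt E x₀.2.1.proj).symm) (f := posProj E)
    (mdifferentiableAt_atlas_symm (chart_mem_atlas E _) (mem_chartDom.1 hy))
    (posProj E).differentiableAt.mdifferentiableAt u
  rw [hfun]
  refine h2.trans ?_
  rw [mfderiv_eq_fderiv, (posProj E).fderiv]
  rfl

theorem vertEndo_chartFrame {x₀ : Phase E Q} {y : ℝ × (E × E) × ℝ} (hy : y ∈ chartDom x₀)
    (u : ℝ × (E × E) × ℝ) :
    vertEndo (chartInv x₀ y) (chartFrame x₀ y u) = chartFrame x₀ y (0, (0, u.2.1.1), 0) := by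
  rw [← vertLift_baseFrame hy, ← mfderiv_base_chartFrame hy]; rfl

theorem partialZ_chartInv {x₀ : Phase E Q} {y : ℝ × (E × E) × ℝ} (hy : y ∈ chartDom x₀) :
    partialZ (chartInv x₀ y) = chartFrame x₀ y (0, (0, 0), 1) := by
  have hfun : (fun s : ℝ => (((chartInv x₀ y).1, (chartInv x₀ y).2.1, s) : Phase E Q)) =
      chartInv x₀ ∘ fun s : ℝ => (y.1, y.2.1, s) := rfl
  have h1 : HasFDerivAt (fun s : ℝ => ((y.1, y.2.1, s) : ℝ × (E × E) × ℝ))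
      ((ContinuousLinearMap.inr ℝ ℝ ((E × E) × ℝ)).comp (ContinuousLinearMap.inr ℝ (E × E) ℝ))
      (chartInv x₀ y).2.2 :=
    ((hasFDerivAt_const y.1 _).prodMk ((hasFDerivAt_const y.2.1 _).prodMk
      (hasFDerivAt_id _))).congr_fderiv (by ext <;> rfl)
  have h2 := mfderiv_comp_apply_of_eq (I := 𝓘(ℝ, ℝ)) (I' := 𝓘(ℝ, ℝ × (E × E) × ℝ))
    (I'' := phaseModel E) (x := (chartInv x₀ y).2.2) (y := y) (mdifferentiableAt_chartInv hy)
    h1.differentiableAt.mdifferentiableAt rfl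
    ((NormedSpace.fromTangentSpace (chartInv x₀ y).2.2).symm 1)
  rw [partialZ, hfun]
  refine h2.trans ?_
  rw [mfderiv_eq_fderiv, h1.fderiv, chartFrame_eq_mfderiv]
  rfl

theorem chartFrame_isInvertible {x₀ : Phase E Q} {y : ℝ × (E × E) × ℝ} (hy : y ∈ chartDom x₀) :
    (chartFrame x₀ y).IsInvertible :=
  have : IsManifold (phaseModel E) 1 (Phase E Q) := .of_le (n := ∞) (by simp)
  isInvertible_mfderivWithin_extChartAt_symm hy

theorem chartFrame_bijective {x₀ : Phase E Q} {y : ℝ × (E × E) × ℝ} (hy : y ∈ chartDom x₀) :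
    Function.Bijective (chartFrame x₀ y) := by
  obtain ⟨e, he⟩ := chartFrame_isInvertible hy
  rw [← he]; exact e.bijective

theorem exists_chartInv_eq (x : Phase E Q) :
    ∃ x₀ : Phase E Q, ∃ y ∈ chartDom x₀, chartInv x₀ y = x :=
  ⟨x, extChartAt (phaseModel E) x x, mem_extChartAt_target x, extChartAt_to_inv x⟩

end PhaseChart

/-! ### The Reeb and Herglotz vector fields in charts -/

section Lagrangian

open Set Filter Topology

variable {E : Type*} [NormedAddCommGroup E] [NormedSpace ℝ E]
  {Q : Type*} [TopologicalSpace Q] [ChartedSpace E Q] [IsManifold 𝓘(ℝ, E) ∞ Q]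
  {L : Phase E Q → ℝ} {x₀ : Phase E Q} {y : ℝ × (E × E) × ℝ}

theorem contDiffAt_comp_chartInv {g : Phase E Q → ℝ}
    (hg : ContMDiff (phaseModel E) 𝓘(ℝ, ℝ) ∞ g) (hy : y ∈ chartDom x₀) :
    ContDiffAt ℝ ∞ (g ∘ chartInv x₀) y := by
  have h : ContMDiffAt 𝓘(ℝ, ℝ × (E × E) × ℝ) (phaseModel E) ∞ (chartInv x₀) y :=
    (contMDiffOn_extChartAt_symm x₀).contMDiffAt ((isOpen_chartDom x₀).mem_nhds hy)
  exact contMDiffAt_iff_contDiffAt.1 ((hg _).comp y h)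

theorem mvfderiv_chartFrame_of_contMDiff {g : Phase E Q → ℝ}
    (hg : ContMDiff (phaseModel E) 𝓘(ℝ, ℝ) ∞ g) (hy : y ∈ chartDom x₀) (u : ℝ × (E × E) × ℝ) :
    mvfderiv (phaseModel E) g (chartInv x₀ y) (chartFrame x₀ y u) =
      fderiv ℝ (g ∘ chartInv x₀) y u :=
  mvfderiv_chartFrame hy ((hg _).mdifferentiableAt (by simp)) u

theorem energy_chartInv (hL : ContMDiff (phaseModel E) 𝓘(ℝ, ℝ) ∞ L) (hy : y ∈ chartDom x₀) :
    energy L (chartInv x₀ y) = localEnergy (L ∘ chartInv x₀) y := by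
  rw [energy, liouville_chartInv hy, mvfderiv_chartFrame_of_contMDiff hL hy]; rfl

theorem cartanForm_chartFrame (hL : ContMDiff (phaseModel E) 𝓘(ℝ, ℝ) ∞ L) (hy : y ∈ chartDom x₀)
    (u : ℝ × (E × E) × ℝ) :
    cartanForm L (chartInv x₀ y) (chartFrame x₀ y u) =
      fderiv ℝ (L ∘ chartInv x₀) y (0, (0, u.2.1.1), 0) := by
  rw [← mvfderiv_chartFrame_of_contMDiff hL hy, ← vertEndo_chartFrame hy]; rfl

theorem etaL_chartFrame (hL : ContMDiff (phaseModel E) 𝓘(ℝ, ℝ) ∞ L) (hy : y ∈ chartDom x₀)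
    (u : ℝ × (E × E) × ℝ) :
    etaL L (chartInv x₀ y) (chartFrame x₀ y u) = localEta (L ∘ chartInv x₀) y u := by
  rw [localEta_apply, ← cartanForm_chartFrame hL hy, ← dz_chartFrame hy]; rfl

theorem etaL_inChart (hL : ContMDiff (phaseModel E) 𝓘(ℝ, ℝ) ∞ L) (hy : y ∈ chartDom x₀) :
    (etaL L).inChart x₀ y = localEta (L ∘ chartInv x₀) y :=
  ContinuousLinearMap.ext fun u => etaL_chartFrame hL hy u

theorem contractD_etaL_chartFrame (hL : ContMDiff (phaseModel E) 𝓘(ℝ, ℝ) ∞ L)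
    (hy : y ∈ chartDom x₀) (u w : ℝ × (E × E) × ℝ) :
    contractD (etaL L) (chartInv x₀ y) (chartFrame x₀ y u) (chartFrame x₀ y w) =
      localOmega (L ∘ chartInv x₀) y u w := by
  have hev : (etaL L).inChart x₀ =ᶠ[𝓝 y] localEta (L ∘ chartInv x₀) := by
    filter_upwards [(isOpen_chartDom x₀).mem_nhds hy] with z hz
    exact etaL_inChart hL hz
  have hd := (hasFDerivAt_localEta (contDiffAt_comp_chartInv hL hy)).differentiableAt
  rw [localOmega, ← hev.fderiv_eq]
  exact contractD_symm_apply (etaL L) x₀ hy (hd.congr_of_eventuallyEq hev) u w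

theorem differentiableAt_localEnergy {ℓ : ℝ × (E × E) × ℝ → ℝ} (hℓ : ContDiffAt ℝ ∞ ℓ y) :
    DifferentiableAt ℝ (localEnergy ℓ) y := by
  have h1 := differentiableAt_fderiv_of_contDiffAt hℓ
  have h2 : DifferentiableAt ℝ ℓ y := hℓ.differentiableAt (by simp)
  unfold localEnergy
  fun_prop

theorem mvfderiv_energy_chartFrame (hL : ContMDiff (phaseModel E) 𝓘(ℝ, ℝ) ∞ L)
    (hy : y ∈ chartDom x₀) (u : ℝ × (E × E) × ℝ) :
    mvfderiv (phaseModel E) (energy L) (chartInv x₀ y) (chartFrame x₀ y u) =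
      fderiv ℝ (localEnergy (L ∘ chartInv x₀)) y u := by
  have hev : energy L ∘ chartInv x₀ =ᶠ[𝓝 y] localEnergy (L ∘ chartInv x₀) := by
    filter_upwards [(isOpen_chartDom x₀).mem_nhds hy] with z hz
    exact energy_chartInv hL hz
  rw [← hev.fderiv_eq]
  exact mvfderiv_chartFrame hy (mdifferentiableAt_chartInv_of_eventuallyEq hy
    (fun z hz => energy_chartInv hL hz)
    (differentiableAt_localEnergy (contDiffAt_comp_chartInv hL hy))) u

/-- Regularity of the Lagrangian, in any chart. -/
theorem localHess_nondegenerate (hL : ContMDiff (phaseModel E) 𝓘(ℝ, ℝ) ∞ L) (hreg : IsRegular L)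
    (hy : y ∈ chartDom x₀) (a : E) (ha : localHess (L ∘ chartInv x₀) y a = 0) : a = 0 := by
  set e := baseFrame x₀.2.1.proj (mem_chartDom.1 hy) with he
  set ℓ := L ∘ chartInv x₀ with hℓ
  have hv : e.symm (velocity (chartInv x₀ y)) = y.2.1.2 := by
    rw [velocity_eq_baseFrame hy, ContinuousLinearEquiv.symm_apply_apply]
  have hwv : withVel y (e.symm (velocity (chartInv x₀ y))) = y := by rw [hv]; rfl
  have hs : ∀ w, HasFDerivAt (fun w : E => withVel y (e.symm w))
      ((velIncl E).comp (e.symm : E →L[ℝ] E)) w := fun w =>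
    (hasFDerivAt_withVel y _).comp _ e.symm.hasFDerivAt
  have hfun : (fun w : E => L (fibreIncl (chartInv x₀ y) w)) =
      fun w : E => ℓ (withVel y (e.symm w)) :=
    funext fun w => congrArg L (fibreIncl_eq_chartInv hy w)
  have h1 : fderiv ℝ (fun w : E => L (fibreIncl (chartInv x₀ y) w)) =
      fun w => ((velIncl E).comp (e.symm : E →L[ℝ] E)).precomp ℝ
        (fderiv ℝ ℓ (withVel y (e.symm w))) := by
    rw [hfun]
    funext w
    have hd : DifferentiableAt ℝ ℓ (withVel y (e.symm w)) :=
      (contDiffAt_comp_chartInv hL (withVel_mem_chartDom hy _)).differentiableAt (by simp)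
    exact (HasFDerivAt.comp w hd.hasFDerivAt (hs w)).fderiv
  have h2 : HasFDerivAt (fun w => ((velIncl E).comp (e.symm : E →L[ℝ] E)).precomp ℝ
        (fderiv ℝ ℓ (withVel y (e.symm w))))
      ((((velIncl E).comp (e.symm : E →L[ℝ] E)).precomp ℝ).comp
        ((fderiv ℝ (fderiv ℝ ℓ) y).comp ((velIncl E).comp (e.symm : E →L[ℝ] E))))
      (velocity (chartInv x₀ y)) := by
    refine HasFDerivAt.comp _ (ContinuousLinearMap.hasFDerivAt _) ?_
    refine HasFDerivAt.comp _ (g := fderiv ℝ ℓ) ?_ (hs _)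
    rw [hwv]
    exact (differentiableAt_fderiv_of_contDiffAt (contDiffAt_comp_chartInv hL hy)).hasFDerivAt
  have h3 := hreg (chartInv x₀ y) (e a) fun w' => by
    rw [h1]
    refine (DFunLike.congr_fun (DFunLike.congr_fun h2.fderiv (e a)) w').trans ?_
    have := DFunLike.congr_fun ha (e.symm w')
    simpa [localHess_apply] using this
  simpa using h3

/-- Existence of the Reeb vector fields: `s = 1`, `r = 0` for the time one and `s = 0`, `r = 1` for
the contact one. -/
theorem exists_reeb [FiniteDimensional ℝ E] (hL : ContMDiff (phaseModel E) 𝓘(ℝ, ℝ) ∞ L)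
    (hreg : IsRegular L) (x : Phase E Q) (s r : ℝ) :
    ∃ u : TangentSpace (phaseModel E) x, dt x u = s ∧ etaL L x u = r ∧
      contractD (etaL L) x u = 0 := by
  obtain ⟨x₀, y, hy, rfl⟩ := exists_chartInv_eq x
  obtain ⟨u, h1, h2, h3⟩ := exists_local_reeb (contDiffAt_comp_chartInv hL hy)
    (localHess_nondegenerate hL hreg hy) s r
  refine ⟨chartFrame x₀ y u, by rw [dt_chartFrame hy, h1], by rw [etaL_chartFrame hL hy, h2], ?_⟩
  ext w
  obtain ⟨w, rfl⟩ := (chartFrame_bijective hy).2 w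
  exact (contractD_etaL_chartFrame hL hy u w).trans (h3 w)

/-- The derivative of the energy along a vector in the kernel of `dη_L`. -/
theorem mvfderiv_energy_of_contractD_eq_zero (hL : ContMDiff (phaseModel E) 𝓘(ℝ, ℝ) ∞ L)
    (hreg : IsRegular L) (hy : y ∈ chartDom x₀)
    {u : TangentSpace (phaseModel E) (chartInv x₀ y)} {s r : ℝ} (hs : dt (chartInv x₀ y) u = s)
    (hr : etaL L (chartInv x₀ y) u = r) (h : contractD (etaL L) (chartInv x₀ y) u = 0) :
    mvfderiv (phaseModel E) (energy L) (chartInv x₀ y) u =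
      -(s * fderiv ℝ (L ∘ chartInv x₀) y (1, (0, 0), 0) +
        r * fderiv ℝ (L ∘ chartInv x₀) y (0, (0, 0), 1)) := by
  obtain ⟨u, rfl⟩ := (chartFrame_bijective hy).2 u
  have h' : ∀ w, localOmega (L ∘ chartInv x₀) y u w = 0 := fun w => by
    rw [← contractD_etaL_chartFrame hL hy, h]; rfl
  have hℓ := contDiffAt_comp_chartInv hL hy
  have hn := localHess_nondegenerate hL hreg hy
  have h3 : ((0, (0, 0), 0) : ℝ × (E × E) × ℝ) = 0 := rfl
  have hq : u.2.1.1 = 0 := pos_eq_zero_of_localOmega hℓ hn fun b => by rw [h', h3, map_zero]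
  rw [dt_chartFrame hy] at hs
  rw [etaL_chartFrame hL hy, localEta_apply, hq, h3, map_zero, sub_zero] at hr
  rw [mvfderiv_energy_chartFrame hL hy, fderiv_localEnergy_of_reeb hℓ hn h', hs, hr]

variable [FiniteDimensional ℝ E]

/-- `R_z(E_L) = -∂L/∂z`, in a chart. -/
theorem mvfderiv_energy_reebZ (hL : ContMDiff (phaseModel E) 𝓘(ℝ, ℝ) ∞ L)
    (hreg : IsRegular L) (hy : y ∈ chartDom x₀) :
    mvfderiv (phaseModel E) (energy L) (chartInv x₀ y) (reebZ dt (etaL L) (chartInv x₀ y)) =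
      -fderiv ℝ (L ∘ chartInv x₀) y (0, (0, 0), 1) := by
  obtain ⟨h1, h2, h3⟩ := Classical.epsilon_spec (exists_reeb hL hreg (chartInv x₀ y) 0 1)
  rw [reebZ, mvfderiv_energy_of_contractD_eq_zero hL hreg hy h1 h2 h3]
  ring

/-- `R_t(E_L) = -∂L/∂t`, in a chart. -/
theorem mvfderiv_energy_reebT (hL : ContMDiff (phaseModel E) 𝓘(ℝ, ℝ) ∞ L)
    (hreg : IsRegular L) (hy : y ∈ chartDom x₀) :
    mvfderiv (phaseModel E) (energy L) (chartInv x₀ y) (reebT dt (etaL L) (chartInv x₀ y)) =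
      -fderiv ℝ (L ∘ chartInv x₀) y (1, (0, 0), 0) := by
  obtain ⟨h1, h2, h3⟩ := Classical.epsilon_spec (exists_reeb hL hreg (chartInv x₀ y) 1 0)
  rw [reebT, mvfderiv_energy_of_contractD_eq_zero hL hreg hy h1 h2 h3]
  ring

/-- The Herglotz vector field `∂/∂t + v^i ∂/∂q^i + A^i ∂/∂v^i + L ∂/∂z` in a chart. -/
noncomputable def localHerglotzField (ℓ : ℝ × (E × E) × ℝ → ℝ) (y : ℝ × (E × E) × ℝ) :
    ℝ × (E × E) × ℝ := (1, (y.2.1.2, herglotzAcc ℓ y), ℓ y)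

theorem herglotzVField_chartInv (hL : ContMDiff (phaseModel E) 𝓘(ℝ, ℝ) ∞ L)
    (hreg : IsRegular L) (hy : y ∈ chartDom x₀) :
    herglotzVField L (chartInv x₀ y) =
      chartFrame x₀ y (localHerglotzField (L ∘ chartInv x₀) y) := by
  have hℓ := contDiffAt_comp_chartInv hL hy
  have hn := localHess_nondegenerate hL hreg hy
  -- In the coordinate frame the defining equations are the coordinate equations.
  have key : ∀ u, (contractD (etaL L) (chartInv x₀ y) (chartFrame x₀ y u) =
        mvfderiv (phaseModel E) (energy L) (chartInv x₀ y)
        - mvfderiv (phaseModel E) (energy L) (chartInv x₀ y)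
            (reebZ dt (etaL L) (chartInv x₀ y)) • etaL L (chartInv x₀ y)
        - mvfderiv (phaseModel E) (energy L) (chartInv x₀ y)
            (reebT dt (etaL L) (chartInv x₀ y)) • dt (chartInv x₀ y) ∧
      etaL L (chartInv x₀ y) (chartFrame x₀ y u) = -energy L (chartInv x₀ y) ∧
        dt (chartInv x₀ y) (chartFrame x₀ y u) = 1) ↔ LocalHerglotz (L ∘ chartInv x₀) y u := by
    intro u
    rw [etaL_chartFrame hL hy, energy_chartInv hL hy, dt_chartFrame hy,
      mvfderiv_energy_reebZ hL hreg hy, mvfderiv_energy_reebT hL hreg hy, LocalHerglotz]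
    refine and_congr_left fun _ => ?_
    have hexp : ∀ w, (mvfderiv (phaseModel E) (energy L) (chartInv x₀ y)
        - -fderiv ℝ (L ∘ chartInv x₀) y (0, (0, 0), 1) • etaL L (chartInv x₀ y)
        - -fderiv ℝ (L ∘ chartInv x₀) y (1, (0, 0), 0) • dt (chartInv x₀ y)) (chartFrame x₀ y w) =
      fderiv ℝ (localEnergy (L ∘ chartInv x₀)) y w +
        fderiv ℝ (L ∘ chartInv x₀) y (0, (0, 0), 1) * localEta (L ∘ chartInv x₀) y w +
        fderiv ℝ (L ∘ chartInv x₀) y (1, (0, 0), 0) * w.1 := by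
      intro w
      rw [← mvfderiv_energy_chartFrame hL hy, ← etaL_chartFrame hL hy, ← dt_chartFrame hy w]
      simp only [sub_apply, smul_apply, smul_eq_mul]
      ring
    constructor
    · intro h w
      rw [← contractD_etaL_chartFrame hL hy, h, hexp]
    · intro h
      ext w
      obtain ⟨w, rfl⟩ := (chartFrame_bijective hy).2 w
      rw [hexp, ← h w]
      exact contractD_etaL_chartFrame hL hy u w
  have hex := (key _).2 ((localHerglotz_iff_eq hℓ hn _).2 rfl)
  have hspec := Classical.epsilon_spec (p := fun u : TangentSpace (phaseModel E) (chartInv x₀ y) =>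
    contractD (etaL L) (chartInv x₀ y) u = mvfderiv (phaseModel E) (energy L) (chartInv x₀ y)
        - mvfderiv (phaseModel E) (energy L) (chartInv x₀ y)
            (reebZ dt (etaL L) (chartInv x₀ y)) • etaL L (chartInv x₀ y)
        - mvfderiv (phaseModel E) (energy L) (chartInv x₀ y)
            (reebT dt (etaL L) (chartInv x₀ y)) • dt (chartInv x₀ y) ∧
      etaL L (chartInv x₀ y) u = -energy L (chartInv x₀ y) ∧ dt (chartInv x₀ y) u = 1) ⟨_, hex⟩
  obtain ⟨u, hu⟩ := (chartFrame_bijective hy).2 (herglotzVField L (chartInv x₀ y))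
  rw [← hu]
  congr 1
  refine (localHerglotz_iff_eq hℓ hn u).1 ((key u).1 ?_)
  rw [hu]
  exact hspec

end Lagrangian

/-! ### Symmetries and dissipated quantities -/

section Symmetry

open Set Filter Topology

variable {E : Type*} [NormedAddCommGroup E] [NormedSpace ℝ E]
  {Q : Type*} [TopologicalSpace Q] [ChartedSpace E Q] [IsManifold 𝓘(ℝ, E) ∞ Q]
  {L : Phase E Q → ℝ}

theorem dt_partialZ (x : Phase E Q) : dt x (partialZ x) = 0 := by
  obtain ⟨x₀, y, hy, rfl⟩ := exists_chartInv_eq x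
  rw [partialZ_chartInv hy, dt_chartFrame hy]

theorem dz_partialZ (x : Phase E Q) : dz x (partialZ x) = 1 := by
  obtain ⟨x₀, y, hy, rfl⟩ := exists_chartInv_eq x
  rw [partialZ_chartInv hy, dz_chartFrame hy]

theorem deriv_action_eq (hL : ContMDiff (phaseModel E) 𝓘(ℝ, ℝ) ∞ L) (x : Phase E Q) :
    deriv (fun s : ℝ => L (x.1, x.2.1, s)) x.2.2 = mvfderiv (phaseModel E) L x (partialZ x) := by
  have hf : ContMDiff 𝓘(ℝ, ℝ) (phaseModel E) ∞ (fun s : ℝ => ((x.1, x.2.1, s) : Phase E Q)) :=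
    contMDiff_const.prodMk (contMDiff_const.prodMk contMDiff_id)
  have h := mfderiv_comp_apply (I := 𝓘(ℝ, ℝ)) (I' := phaseModel E) (I'' := 𝓘(ℝ, ℝ)) x.2.2
    ((hL _).mdifferentiableAt (by simp)) ((hf _).mdifferentiableAt (by simp))
    ((NormedSpace.fromTangentSpace x.2.2).symm 1)
  rw [mfderiv_eq_fderiv] at h
  exact h

/-- The coefficient of a smooth multiple of `∂/∂z` is its `dz`-component, hence smooth. -/
theorem contMDiff_of_smul_partialZ {Z : VField (phaseModel E) (Phase E Q)} {ζ : Phase E Q → ℝ}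
    (hZ : IsSmoothVField Z) (h : ∀ x, Z x = ζ x • partialZ x) :
    ContMDiff (phaseModel E) 𝓘(ℝ, ℝ) ∞ ζ := by
  have hz : ContMDiff (phaseModel E) 𝓘(ℝ, ℝ) ∞ (fun y : Phase E Q => y.2.2) :=
    contMDiff_snd.snd
  have h1 : ContMDiff (phaseModel E).tangent 𝓘(ℝ, ℝ).tangent ∞
      (tangentMap (phaseModel E) 𝓘(ℝ, ℝ) (fun y : Phase E Q => y.2.2)) :=
    hz.contMDiff_tangentMap (by simp)
  have h2 := (contMDiff_snd_tangentBundle_modelSpace (n := ∞) (I := 𝓘(ℝ, ℝ)) (H := ℝ)).comp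
    (h1.comp hZ)
  convert h2 using 1
  funext x
  have h3 : dz x (Z x) = ζ x := by rw [h, map_smul, dz_partialZ, smul_eq_mul, mul_one]
  exact h3.symm

/-- The image under the differential of a fibre-preserving map `(t, v_q, z) ↦ (t, v_q, Φ_z)` has
`dz`-component `dΦ_z` and the same projection to the configuration manifold. -/
theorem etaL_mfderiv_changeOfAction {Φ : Phase E Q → Phase E Q} {Φz : Phase E Q → ℝ}
    (hΦ : ContMDiff (phaseModel E) (phaseModel E) ∞ Φ) (h : ∀ x, Φ x = (x.1, x.2.1, Φz x))
    (y : Phase E Q) (u : TangentSpace (phaseModel E) y) {w : E}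
    (hw : mfderiv (phaseModel E) 𝓘(ℝ, E) (fun y : Phase E Q => y.2.1.proj) y u = w) :
    etaL L (Φ y) (mfderiv (phaseModel E) (phaseModel E) Φ y u) =
      mvfderiv (phaseModel E) Φz y u - mvfderiv (phaseModel E) L (Φ y) (vertLift (Φ y) w) := by
  have hd : MDifferentiableAt (phaseModel E) (phaseModel E) Φ y :=
    (hΦ y).mdifferentiableAt (by simp)
  have h1 : dz (Φ y) (mfderiv (phaseModel E) (phaseModel E) Φ y u) =
      mvfderiv (phaseModel E) Φz y u := by
    have hc : (fun y : Phase E Q => y.2.2) ∘ Φ = Φz := funext fun x => by simp [h x]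
    have := mfderiv_comp_apply (g := fun y : Phase E Q => y.2.2) (I'' := 𝓘(ℝ, ℝ)) y
      mdifferentiableAt_snd.snd hd u
    rw [hc] at this
    exact this.symm
  have h2 : mfderiv (phaseModel E) 𝓘(ℝ, E) (fun y : Phase E Q => y.2.1.proj) (Φ y)
      (mfderiv (phaseModel E) (phaseModel E) Φ y u) = w := by
    have hc : (fun y : Phase E Q => y.2.1.proj) ∘ Φ = fun y => y.2.1.proj :=
      funext fun x => by simp [h x]
    have := mfderiv_comp_apply (g := fun y : Phase E Q => y.2.1.proj) (I'' := 𝓘(ℝ, E)) y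
      (mdifferentiableAt_base _) hd u
    rw [hc] at this
    exact this.symm.trans hw
  rw [← h1, ← h2]
  rfl

theorem pushforward_apply (Φ : Phase E Q ≃ₘ⟮phaseModel E, phaseModel E⟯ Phase E Q)
    (X : VField (phaseModel E) (Phase E Q)) (x : Phase E Q) :
    pushforward Φ X x = mfderiv (phaseModel E) (phaseModel E) Φ (Φ.symm x) (X (Φ.symm x)) := by
  have hd : MDifferentiableAt (phaseModel E) (phaseModel E) Φ (Φ.symm x) :=
    (Φ.contMDiff _).mdifferentiableAt (by simp)
  have hd' : MDifferentiableAt (phaseModel E) (phaseModel E) Φ.symm x :=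
    (Φ.symm.contMDiff _).mdifferentiableAt (by simp)
  have h1 : ∀ v : ℝ × (E × E) × ℝ, mfderiv (phaseModel E) (phaseModel E) Φ (Φ.symm x)
      (mfderiv (phaseModel E) (phaseModel E) Φ.symm x v) = v := fun v => by
    have h := mfderiv_comp_apply x hd hd' v
    have hid : Φ ∘ Φ.symm = id := funext fun z => Φ.apply_symm_apply z
    rw [hid, mfderiv_id] at h
    exact h.symm
  have h2 : ∀ v : ℝ × (E × E) × ℝ, mfderiv (phaseModel E) (phaseModel E) Φ.symm x
      (mfderiv (phaseModel E) (phaseModel E) Φ (Φ.symm x) v) = v := fun v => by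
    have h := mfderiv_comp_apply_of_eq (I'' := phaseModel E) (g := Φ.symm) (y := x) (Φ.symm x)
      hd' hd (Φ.apply_symm_apply x) v
    have hid : Φ.symm ∘ Φ = id := funext fun z => Φ.symm_apply_apply z
    rw [hid, mfderiv_id] at h
    exact h.symm
  exact DFunLike.congr_fun (ContinuousLinearMap.inverse_eq
    (f := (mfderiv (phaseModel E) (phaseModel E) Φ.symm x : ℝ × (E × E) × ℝ →L[ℝ] ℝ × (E × E) × ℝ))
    (g := (mfderiv (phaseModel E) (phaseModel E) Φ (Φ.symm x) :
      ℝ × (E × E) × ℝ →L[ℝ] ℝ × (E × E) × ℝ))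
    (ContinuousLinearMap.ext h2) (ContinuousLinearMap.ext h1)) (X (Φ.symm x))

variable [FiniteDimensional ℝ E]

theorem etaL_herglotzVField (hL : ContMDiff (phaseModel E) 𝓘(ℝ, ℝ) ∞ L) (hreg : IsRegular L)
    (x : Phase E Q) : etaL L x (herglotzVField L x) = -energy L x := by
  obtain ⟨x₀, y, hy, rfl⟩ := exists_chartInv_eq x
  rw [herglotzVField_chartInv hL hreg hy, etaL_chartFrame hL hy, energy_chartInv hL hy]
  simp [localEnergy, localHerglotzField]

/-- The Herglotz vector field satisfies the second-order condition. -/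
theorem mfderiv_base_herglotzVField (hL : ContMDiff (phaseModel E) 𝓘(ℝ, ℝ) ∞ L)
    (hreg : IsRegular L) (x : Phase E Q) :
    mfderiv (phaseModel E) 𝓘(ℝ, E) (fun y : Phase E Q => y.2.1.proj) x (herglotzVField L x) =
      velocity x := by
  obtain ⟨x₀, y, hy, rfl⟩ := exists_chartInv_eq x
  rw [herglotzVField_chartInv hL hreg hy, mfderiv_base_chartFrame hy, velocity_eq_baseFrame hy]
  rfl

/-- `R_z(E_L) = -∂L/∂z`. -/
theorem mvfderiv_energy_reebZ_eq (hL : ContMDiff (phaseModel E) 𝓘(ℝ, ℝ) ∞ L)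
    (hreg : IsRegular L) (x : Phase E Q) :
    mvfderiv (phaseModel E) (energy L) x (reebZ dt (etaL L) x) =
      -mvfderiv (phaseModel E) L x (partialZ x) := by
  obtain ⟨x₀, y, hy, rfl⟩ := exists_chartInv_eq x
  rw [mvfderiv_energy_reebZ hL hreg hy, partialZ_chartInv hy,
    mvfderiv_chartFrame_of_contMDiff hL hy]

/-- By the second-order condition, `θ_L` takes on the image of the Herglotz vector field the value
`Δ(L) = E_L + L`. -/
theorem etaL_mfderiv_herglotzVField (hL : ContMDiff (phaseModel E) 𝓘(ℝ, ℝ) ∞ L)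
    (hreg : IsRegular L) {Φ : Phase E Q → Phase E Q} {Φz : Phase E Q → ℝ}
    (hΦ : ContMDiff (phaseModel E) (phaseModel E) ∞ Φ) (h : ∀ x, Φ x = (x.1, x.2.1, Φz x))
    (y : Phase E Q) :
    etaL L (Φ y) (mfderiv (phaseModel E) (phaseModel E) Φ y (herglotzVField L y)) =
      mvfderiv (phaseModel E) Φz y (herglotzVField L y) - L (Φ y) - energy L (Φ y) := by
  have hv : velocity y = velocity (Φ y) := by rw [h y]; rfl
  rw [etaL_mfderiv_changeOfAction hΦ h y _ (mfderiv_base_herglotzVField hL hreg y), hv, energy]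
  simp only [liouville, velocity]
  ring

/-- A change of action is a generalized dynamical symmetry exactly when it satisfies
`Γ_L(Φ_z) = L ∘ Φ`. -/
theorem isGeneralizedDynamicalSymmetry_iff (hL : ContMDiff (phaseModel E) 𝓘(ℝ, ℝ) ∞ L)
    (hreg : IsRegular L) (Φ : Phase E Q ≃ₘ⟮phaseModel E, phaseModel E⟯ Phase E Q)
    (Φz : Phase E Q → ℝ) (h : ∀ x, Φ x = (x.1, x.2.1, Φz x)) :
    IsGeneralizedDynamicalSymmetry dt (etaL L) (energy L) Φ ↔
      ∀ x, mvfderiv (phaseModel E) Φz x (herglotzVField L x) = L (Φ x) := by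
  have key : ∀ x, etaL L x (pushforward Φ (herglotzVField L) x) =
      mvfderiv (phaseModel E) Φz (Φ.symm x) (herglotzVField L (Φ.symm x)) - L x - energy L x := by
    intro x
    have aux : ∀ y, Φ y = x →
        etaL L x (mfderiv (phaseModel E) (phaseModel E) Φ y (herglotzVField L y)) =
          mvfderiv (phaseModel E) Φz y (herglotzVField L y) - L x - energy L x := by
      rintro y rfl
      exact etaL_mfderiv_herglotzVField hL hreg Φ.contMDiff h y
    rw [pushforward_apply]
    exact aux _ (Φ.apply_symm_apply x)
  constructor
  · rintro ⟨h1, -⟩ x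
    have h2 := h1 (Φ x)
    have h3 := key (Φ x)
    have h4 := etaL_herglotzVField hL hreg (Φ x)
    rw [Φ.symm_apply_apply] at h3
    have h5 := h3.symm.trans (h2.trans h4)
    linarith
  · intro h1
    refine ⟨fun x => ?_, fun x => by rw [h x]⟩
    have h2 := h1 (Φ.symm x)
    rw [Φ.apply_symm_apply] at h2
    refine (key x).trans (Eq.trans ?_ (etaL_herglotzVField hL hreg x).symm)
    rw [h2]; ring

theorem hasFDerivAt_localHerglotzField {ℓ : ℝ × (E × E) × ℝ → ℝ} {y : ℝ × (E × E) × ℝ}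
    (hℓ : ContDiffAt ℝ ∞ ℓ y) (hreg : ∀ a, localHess ℓ y a = 0 → a = 0) :
    HasFDerivAt (localHerglotzField ℓ) ((0 : ℝ × (E × E) × ℝ →L[ℝ] ℝ).prod
      (((velProj E).prod (fderiv ℝ (herglotzAcc ℓ) y)).prod (fderiv ℝ ℓ y))) y :=
  (hasFDerivAt_const (1 : ℝ) y).prodMk (((velProj E).hasFDerivAt.prodMk
    (differentiableAt_herglotzAcc hℓ hreg).hasFDerivAt).prodMk
    (hℓ.differentiableAt (by simp)).hasFDerivAt)

/-- The coordinate computation of `η_L([ζ ∂/∂z, Γ_L])`. -/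
theorem localEta_lieBracket {ℓ ζ : ℝ × (E × E) × ℝ → ℝ} {y : ℝ × (E × E) × ℝ}
    (hℓ : ContDiffAt ℝ ∞ ℓ y) (hreg : ∀ a, localHess ℓ y a = 0 → a = 0)
    (hζ : DifferentiableAt ℝ ζ y) :
    localEta ℓ y (VectorField.lieBracket ℝ (fun z => (0, (0, 0), ζ z)) (localHerglotzField ℓ) y) =
      ζ y * fderiv ℝ ℓ y (0, (0, 0), 1) - fderiv ℝ ζ y (localHerglotzField ℓ y) := by
  have h1 : HasFDerivAt (fun z => ((0, (0, 0), ζ z) : ℝ × (E × E) × ℝ))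
      ((0 : ℝ × (E × E) × ℝ →L[ℝ] ℝ).prod ((0 : ℝ × (E × E) × ℝ →L[ℝ] E × E).prod
        (fderiv ℝ ζ y))) y :=
    (hasFDerivAt_const (0 : ℝ) y).prodMk ((hasFDerivAt_const ((0, 0) : E × E) y).prodMk
      hζ.hasFDerivAt)
  have h3 : ((0, (0, 0), 0) : ℝ × (E × E) × ℝ) = 0 := rfl
  have h4 : ((0, (0, 0), ζ y) : ℝ × (E × E) × ℝ) = ζ y • (0, (0, 0), 1) := by simp
  rw [VectorField.lieBracket, h1.fderiv, (hasFDerivAt_localHerglotzField hℓ hreg).fderiv,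
    localEta_apply]
  have h5 : fderiv ℝ ℓ y (0, (0, 0), ζ y) = ζ y * fderiv ℝ ℓ y (0, (0, 0), 1) := by
    rw [h4, map_smul, smul_eq_mul]
  simp [h3, h5]

/-- `η_L([ζ ∂/∂z, Γ_L]) = ζ ∂L/∂z - Γ_L(ζ)`. -/
theorem etaL_mlieBracket (hL : ContMDiff (phaseModel E) 𝓘(ℝ, ℝ) ∞ L) (hreg : IsRegular L)
    {Z : VField (phaseModel E) (Phase E Q)} {ζ : Phase E Q → ℝ}
    (hζ : ContMDiff (phaseModel E) 𝓘(ℝ, ℝ) ∞ ζ) (hZ : ∀ x, Z x = ζ x • partialZ x)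
    (x : Phase E Q) :
    etaL L x (VectorField.mlieBracket (phaseModel E) Z (herglotzVField L) x) =
      ζ x * mvfderiv (phaseModel E) L x (partialZ x) -
        mvfderiv (phaseModel E) ζ x (herglotzVField L x) := by
  have : IsManifold (phaseModel E) 1 (Phase E Q) := .of_le (n := ∞) (by simp)
  set p := extChartAt (phaseModel E) x x with hp
  have hpd : p ∈ chartDom x := mem_extChartAt_target x
  have hpx : chartInv x p = x := extChartAt_to_inv x
  set ℓ := L ∘ chartInv x with hℓ
  have h1 : ζ x * mvfderiv (phaseModel E) L x (partialZ x) =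
      (ζ ∘ chartInv x) p * fderiv ℝ ℓ p (0, (0, 0), 1) := by
    have h := mvfderiv_chartFrame_of_contMDiff hL hpd (0, (0, 0), 1)
    rw [← partialZ_chartInv hpd] at h
    rw [← h, Function.comp_apply, hpx]
  have h2 : mvfderiv (phaseModel E) ζ x (herglotzVField L x) =
      fderiv ℝ (ζ ∘ chartInv x) p (localHerglotzField ℓ p) := by
    have h := mvfderiv_chartFrame_of_contMDiff hζ hpd (localHerglotzField ℓ p)
    rw [← herglotzVField_chartInv hL hreg hpd] at h
    rw [← h, hpx]
  have hZ' : VectorField.mpullbackWithin 𝓘(ℝ, ℝ × (E × E) × ℝ) (phaseModel E)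
      (extChartAt (phaseModel E) x).symm Z (range (phaseModel E)) =ᶠ[𝓝 p]
      fun z => (0, (0, 0), (ζ ∘ chartInv x) z) := by
    filter_upwards [(isOpen_chartDom x).mem_nhds hpd] with z hz
    change (chartFrame x z).inverse (Z (chartInv x z)) = _
    rw [hZ, partialZ_chartInv hz, ← map_smul, (chartFrame_isInvertible hz).inverse_apply_eq]
    simp
  have hΓ' : VectorField.mpullbackWithin 𝓘(ℝ, ℝ × (E × E) × ℝ) (phaseModel E)
      (extChartAt (phaseModel E) x).symm (herglotzVField L) (range (phaseModel E)) =ᶠ[𝓝 p]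
      localHerglotzField ℓ := by
    filter_upwards [(isOpen_chartDom x).mem_nhds hpd] with z hz
    change (chartFrame x z).inverse (herglotzVField L (chartInv x z)) = _
    rw [herglotzVField_chartInv hL hreg hz, (chartFrame_isInvertible hz).inverse_apply_eq]
  -- At its base point the preferred chart has derivative the identity.
  have hη : ∀ b : ℝ × (E × E) × ℝ, etaL L x b = localEta ℓ p b := by
    intro b
    rw [← etaL_inChart hL hpd]
    have h3 := (etaL L).comp_congr_point hpx (chartFrame x p)
    have h4 : chartFrame x p = ContinuousLinearMap.id ℝ _ := mfderivWithin_range_extChartAt_symm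
    refine Eq.trans ?_ (DFunLike.congr_fun h3 b).symm
    exact congrArg (etaL L x) (DFunLike.congr_fun h4 b).symm
  have hbr : VectorField.mlieBracket (phaseModel E) Z (herglotzVField L) x =
      VectorField.lieBracket ℝ (fun z => (0, (0, 0), (ζ ∘ chartInv x) z))
        (localHerglotzField ℓ) p := by
    have hinv : ∀ T : ℝ × (E × E) × ℝ →L[ℝ] ℝ × (E × E) × ℝ, T = ContinuousLinearMap.id ℝ _ →
        ∀ b, T.inverse b = b := by
      rintro T rfl b
      rw [ContinuousLinearMap.inverse_id]; rfl
    have hlb : ∀ V W : ℝ × (E × E) × ℝ → ℝ × (E × E) × ℝ, VectorField.lieBracketWithin ℝ V W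
        ((extChartAt (phaseModel E) x).symm ⁻¹' univ ∩ range (phaseModel E)) p =
          VectorField.lieBracket ℝ V W p := by
      intro V W
      rw [preimage_univ, univ_inter, (phaseModel E).range_eq_univ,
        VectorField.lieBracketWithin_univ]
    exact (hinv _ mfderiv_extChartAt_self _).trans
      ((hlb _ _).trans (hZ'.lieBracket_vectorField_eq hΓ'))
  rw [hbr, h1, h2, ← localEta_lieBracket (contDiffAt_comp_chartInv hL hpd)
    (localHess_nondegenerate hL hreg hpd)
    ((contDiffAt_comp_chartInv hζ hpd).differentiableAt (by simp))]
  exact hη _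

end Symmetry

end Cocontact

theorem mainTheorem12
    {E : Type*} [NormedAddCommGroup E] [NormedSpace ℝ E] [FiniteDimensional ℝ E]
    {Q : Type*} [TopologicalSpace Q] [ChartedSpace E Q] [IsManifold 𝓘(ℝ, E) ∞ Q]
    [T2Space Q] [SecondCountableTopology Q] [ConnectedSpace Q]
    (L : Cocontact.Phase E Q → ℝ)
    (hL : ContMDiff (Cocontact.phaseModel E) 𝓘(ℝ, ℝ) ∞ L)
    (hreg : Cocontact.IsRegular L) :
    (∀ (Φ : Cocontact.Phase E Q ≃ₘ⟮Cocontact.phaseModel E, Cocontact.phaseModel E⟯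
            Cocontact.Phase E Q)
        (Φz : Cocontact.Phase E Q → ℝ),
      Cocontact.IsChangeOfAction Φ →
      (∀ x, Φ x = (x.1, x.2.1, Φz x)) →
      (Cocontact.IsGeneralizedDynamicalSymmetry Cocontact.dt (Cocontact.etaL L)
          (Cocontact.energy L) Φ ↔
        ∀ x, mvfderiv (Cocontact.phaseModel E) Φz x (Cocontact.herglotzVField L x) = L (Φ x))) ∧
    (∀ (Z : Cocontact.VField (Cocontact.phaseModel E) (Cocontact.Phase E Q))
        (ζ : Cocontact.Phase E Q → ℝ),
      Cocontact.IsInfinitesimalChangeOfAction Z →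
      (∀ x, Z x = ζ x • Cocontact.partialZ x) →
      (Cocontact.IsGeneralizedInfinitesimalDynamicalSymmetry Cocontact.dt (Cocontact.etaL L)
          (Cocontact.energy L) Z ↔
        Cocontact.IsDissipatedQuantity Cocontact.dt (Cocontact.etaL L) (Cocontact.energy L) ζ) ∧
      (Cocontact.IsDissipatedQuantity Cocontact.dt (Cocontact.etaL L) (Cocontact.energy L) ζ ↔
        ∀ x, mvfderiv (Cocontact.phaseModel E) ζ x (Cocontact.herglotzVField L x) =
          ζ x * deriv (fun s : ℝ => L (x.1, x.2.1, s)) x.2.2)) := by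
  refine ⟨fun Φ Φz _ hΦ => Cocontact.isGeneralizedDynamicalSymmetry_iff hL hreg Φ Φz hΦ,
    fun Z ζ hZ hZζ => ?_⟩
  have hζ := Cocontact.contMDiff_of_smul_partialZ hZ.1 hZζ
  have hdis : Cocontact.IsDissipatedQuantity Cocontact.dt (Cocontact.etaL L)
      (Cocontact.energy L) ζ ↔ ∀ x, mvfderiv (Cocontact.phaseModel E) ζ x
        (Cocontact.herglotzVField L x) =
          ζ x * deriv (fun s : ℝ => L (x.1, x.2.1, s)) x.2.2 := by
    refine (and_iff_right hζ).trans (forall_congr' fun x => ?_)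
    rw [Cocontact.mvfderiv_energy_reebZ_eq hL hreg, Cocontact.deriv_action_eq hL, neg_neg, mul_comm]
    rfl
  refine ⟨Iff.trans ?_ hdis.symm, hdis⟩
  refine (and_iff_right hZ.1).trans ((and_iff_left fun x => ?_).trans (forall_congr' fun x => ?_))
  · rw [hZζ, map_smul, Cocontact.dt_partialZ, smul_zero]
  · have h := Cocontact.etaL_mlieBracket hL hreg hζ hZζ x
    rw [Cocontact.deriv_action_eq hL]
    exact (iff_of_eq (congrArg (· = 0) h)).trans (sub_eq_zero.trans eq_comm)
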